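/- Let $b>a>0$. Let $X_1,X_2,\dots$ and $Y_1,Y_2,\dots$ be two sequences of non-negative random variables, each of them iid, and independent of each other, with $\mathbf E X_1^2<\infty$ and $\mathbf E Y_1<\infty$; put $a_1=\mathbf E X_1$, $b_1=\mathbf E Y_1$. Let $\tau(t)=t$. Given $X=(X_i)_{i\ge1}$ and $Y=(Y_j)_{j\ge1}$, let $H_{X,Y}$ be the random bipartite graph with parts $V=\{v_1,v_2,\dots\}$ and $W=\{w_1,w_2,\dots\}$ in which the edges $\{w_i,v_j\}$ are present independently with probabilities $$p_{ij}=\min\Bigl\{1,\frac{X_iY_j}{\sqrt{ij}}\Bigr\}\,\mathbb I_{\{a\tau(j)\le i\le b\tau(j)\}}.$$ Let $G_{X,Y}$ be the graph on $V$ in which two distinct vertices are adjacent whenever they have a common neighbour in $H_{X,Y}$, and let $d(v_t)$ be the degree of $v_t$ in $G_{X,Y}$. Then, as $t\to+\infty$, $d(v_t)$ converges in distribution to $$d_*=\sum_{j=1}^{\Lambda_1}\varkappa_j,$$ where $\varkappa_1,\varkappa_2,\dots$ are iid random variables independent of $\Lambda_1$, and for $r=0,1,2,\dots$ $$\mathbf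 P(\varkappa_1=r)=\frac{r+1}{\mathbf E\Lambda_2}\,\mathbf P(\Lambda_2=r+1),\qquad \mathbf P(\Lambda_i=r)=\mathbf E\,e^{-\lambda_i}\frac{\lambda_i^r}{r!},\quad i=1,2,$$ with $\lambda_1=2(b^{1/2}-a^{1/2})a_1Y_1$ and $\lambda_2=2(a^{-1/2}-b^{-1/2})b_1X_1$. (If $\mathbf E\Lambda_2=0$, that is, if $X_1=0$ almost surely or $Y_1=0$ almost surely, then $\Lambda_1=0$ almost surely and $d_*=0$, whatever the law of the non-negative integer-valued $\varkappa_j$.) -/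

import Mathlib

open MeasureTheory ProbabilityTheory Filter

noncomputable section

/-- The probability `p_{ij} = min{1, x y / √(i j)} · 𝟙{a τ(j) ≤ i ≤ b τ(j)}` of the edge between the
item `w_i` of weight `x` and the actor `v_j` of weight `y`. -/
def edgeProb (a b : ℝ) (τ : ℕ+ → ℝ) (x y : ℝ) (i j : ℕ+) : ℝ :=
  open Classical in
  if a * τ j ≤ (i : ℝ) ∧ (i : ℝ) ≤ b * τ j then
    min 1 (x * y / Real.sqrt ((i : ℝ) * (j : ℝ)))
  else 0

/-- The σ-algebra generated by all the weights `X_i` and `Y_j`. -/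
abbrev weightSigma {Ω : Type*} (X Y : ℕ+ → Ω → ℝ) : MeasurableSpace Ω :=
  (⨆ i, MeasurableSpace.comap (X i) inferInstance) ⊔
    (⨆ j, MeasurableSpace.comap (Y j) inferInstance)

/-- `H` is the random bipartite graph `H_{X,Y}`: `H ω i j` says that the edge `{w_i, v_j}` is
present. The weights `X_1, X_2, …` and `Y_1, Y_2, …` are non-negative, each sequence is iid, and the
two sequences are independent of each other; given all the weights, the edges are independent and
`{w_i, v_j}` is present with probability `p_{ij}`. -/
structure IsRandomBipartiteGraph {Ω : Type*} [MeasurableSpace Ω] (P : Measure Ω)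
    (a b : ℝ) (τ : ℕ+ → ℝ) (X Y : ℕ+ → Ω → ℝ) (H : Ω → ℕ+ → ℕ+ → Prop) : Prop where
  measurable_X : ∀ i, Measurable (X i)
  measurable_Y : ∀ j, Measurable (Y j)
  nonneg_X : ∀ i, ∀ᵐ ω ∂P, 0 ≤ X i ω
  nonneg_Y : ∀ j, ∀ᵐ ω ∂P, 0 ≤ Y j ω
  iIndep_X : iIndepFun X P
  iIndep_Y : iIndepFun Y P
  identDistrib_X : ∀ i, IdentDistrib (X i) (X 1) P P
  identDistrib_Y : ∀ j, IdentDistrib (Y j) (Y 1) P P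
  indep_X_Y : IndepFun (fun ω i => X i ω) (fun ω j => Y j ω) P
  measurableSet_edge : ∀ i j, MeasurableSet {ω | H ω i j}
  /-- Conditionally on the weights, any finite set `S` of edges is present with probability
  `∏_{(i,j) ∈ S} p_{ij}`. -/
  condProb_edges : ∀ S : Finset (ℕ+ × ℕ+),
    P[Set.indicator {ω | ∀ e ∈ S, H ω e.1 e.2} (fun _ => (1 : ℝ)) | weightSigma X Y]
      =ᵐ[P] fun ω => ∏ e ∈ S, edgeProb a b τ (X e.1 ω) (Y e.2 ω) e.1 e.2

/-- The intersection graph on the actors `v_1, v_2, …` of a bipartite graph: two distinct actors are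
adjacent when they share an item. -/
def intersectionGraph (h : ℕ+ → ℕ+ → Prop) : SimpleGraph ℕ+ where
  Adj s t := s ≠ t ∧ ∃ i, h i s ∧ h i t
  symm := ⟨fun _ _ hst => ⟨hst.1.symm, hst.2.imp fun _ hi => ⟨hi.2, hi.1⟩⟩⟩
  loopless := ⟨fun _ hs => hs.1 rfl⟩

/-- The degree `d(v_t)` of `v_t` in the intersection graph (almost surely finite in the model). -/
def vertexDegree (h : ℕ+ → ℕ+ → Prop) (t : ℕ+) : ℕ :=
  ((intersectionGraph h).neighborSet t).ncard

/-- `Λ` has the mixed Poisson distribution with random mean `lam`: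
`P(Λ = r) = E e^{-lam} lam^r / r!` for all `r`. -/
structure IsMixedPoisson {Ω Ω' : Type*} [MeasurableSpace Ω] [MeasurableSpace Ω']
    (Q : Measure Ω') (Λ : Ω' → ℕ) (P : Measure Ω) (lam : Ω → ℝ) : Prop where
  measurable : Measurable Λ
  prob_eq : ∀ r : ℕ, Q.real {ω' | Λ ω' = r} =
    ∫ ω, Real.exp (-lam ω) * lam ω ^ r / (r.factorial : ℝ) ∂P

/-- `Λ₁, Λ₂` are mixed Poisson with random means `lam₁, lam₂`, and `ϰ 0, ϰ 1, …` are iid,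
independent of `Λ₁`, with the size-biased distribution
`P(ϰ = r) = (r + 1) P(Λ₂ = r + 1) / E Λ₂`. When `E Λ₂ = 0` that formula makes no sense and the
distribution of the `ϰ j` is left free. -/
structure IsCompoundFamily {Ω Ω' : Type*} [MeasurableSpace Ω] [MeasurableSpace Ω']
    (P : Measure Ω) (lam₁ lam₂ : Ω → ℝ) (Q : Measure Ω')
    (Λ₁ Λ₂ : Ω' → ℕ) (ϰ : ℕ → Ω' → ℕ) : Prop where
  mixedPoisson₁ : IsMixedPoisson Q Λ₁ P lam₁
  mixedPoisson₂ : IsMixedPoisson Q Λ₂ P lam₂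
  measurable_ϰ : ∀ j, Measurable (ϰ j)
  iIndep_ϰ : iIndepFun ϰ Q
  identDistrib_ϰ : ∀ j, IdentDistrib (ϰ j) (ϰ 0) Q Q
  indep_Λ₁_ϰ : IndepFun Λ₁ (fun ω' j => ϰ j ω') Q
  prob_ϰ : (∫ ω', (Λ₂ ω' : ℝ) ∂Q) ≠ 0 → ∀ j r : ℕ, Q.real {ω' | ϰ j ω' = r} =
    ((r : ℝ) + 1) / (∫ ω', (Λ₂ ω' : ℝ) ∂Q) * Q.real {ω' | Λ₂ ω' = r + 1}

end

open scoped Topology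

/-! For variables with values in ℕ, convergence in distribution follows from convergence of E s^N
for every s in [0, 1] (`tendstoInDistribution_of_tendsto_pgf`), so generating functions are
compared. Put u = 1 - s throughout.

The degree of v_t is replaced by the number of paths v_t, w_i, v_j with j ≠ t. The two can differ
only if v_t lies on a 4-cycle of H, and the expected number of such cycles given the weights,
truncated at 1, has mean tending to 0 (`IsRandomBipartiteGraph.tendsto_integral_sharedPairs`). Given
the weights, edges at different items are independent, so the conditional generating function of the
path count is the finite product of 1 - p_it (1 - ∏_j (1 - u p_ij)) over the items i
(`pow_pathCount`, `IsRandomBipartiteGraph.hasCondMean_prod_items`).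

For fixed weight sequences that obey the law of large numbers, this product converges. By summation
by parts, ∑ z_i / √(i t) over a t ≤ i ≤ b t tends to 2(√b - √a) times the mean of z. Hence the
product over j is close to exp(-u x_i c) with c = 2(a^(-1/2) - b^(-1/2)) b_1, and the product over i
tends to exp(-y · 2(√b - √a) · E[X(1 - exp(-u X c))]), where y is the weight of v_t
(`tendsto_weightPGF_update`). That weight changes with t, which obstructs an almost sure limit.
Resampling it independently leaves the joint law unchanged, so y can be frozen, the limit taken
almost surely in the other weights, and the result integrated by dominated convergence
(`IsRandomBipartiteGraph.tendsto_integral_of_update`).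

For the limit law, let g be the generating function of the size-biased variable at s. Then E g^Λ₁ =
E exp(-λ₁(1 - g)) and, outside the degenerate case, a_1 g = E[X exp(-u X c)], which gives the same
expression (`IsCompoundFamily.integral_pow_sum_eq`). -/

/-! ### Cesàro means and weighted sums over windows -/

/-- The averages of `z 1, …, z n` converge to `m`. -/
def CesaroTendsto (z : ℕ+ → ℝ) (m : ℝ) : Prop :=
  Tendsto (fun n : ℕ => (∑ k ∈ Finset.range n, z k.succPNat) / n) atTop (𝓝 m)

/-- The finite set of all positive integers in `[α t, β t]`. -/
noncomputable def window (α β : ℝ) (t : ℕ+) : Finset ℕ+ :=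
  open Classical in
  -- Any finite superset would do; the successor keeps the bound positive when the floor is zero.
  (Finset.Iic (⌊β * t⌋₊.succPNat)).filter fun i => α * t ≤ (i : ℝ) ∧ (i : ℝ) ≤ β * t

theorem mem_window {α β : ℝ} {t i : ℕ+} :
    i ∈ window α β t ↔ α * t ≤ (i : ℝ) ∧ (i : ℝ) ≤ β * t := by
  unfold window
  rw [Finset.mem_filter, Finset.mem_Iic]
  refine ⟨fun h => h.2, fun h => ⟨?_, h⟩⟩
  rw [← PNat.coe_le_coe, Nat.succPNat_coe]
  exact (Nat.le_floor h.2).trans (Nat.le_succ _)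

/-- Position `k` in a range stands for the integer k + 1, so the integers strictly below α t occupy
the first ⌈α t⌉ - 1 positions. -/
theorem sum_window {α β : ℝ} (hα : 0 < α) (hab : α ≤ β) (t : ℕ+) (f : ℕ+ → ℝ) :
    ∑ i ∈ window α β t, f i = ∑ k ∈ Finset.range ⌊β * t⌋₊, f k.succPNat -
      ∑ k ∈ Finset.range (⌈α * t⌉₊ - 1), f k.succPNat := by
  have ht : (0 : ℝ) < t := by exact_mod_cast t.pos
  have hle : α * t ≤ β * t := by gcongr
  have hpos : 0 < α * t := by positivity
  have hsub : Finset.range (⌈α * t⌉₊ - 1) ⊆ Finset.range ⌊β * t⌋₊ := by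
    intro k hk
    rw [Finset.mem_range] at hk ⊢
    have : k + 1 < ⌈α * t⌉₊ := by omega
    have h2 := (Nat.lt_ceil.1 this).le.trans hle
    exact Nat.lt_of_succ_le (Nat.le_floor h2)
  rw [eq_sub_iff_add_eq, ← Finset.sum_sdiff hsub]
  congr 1
  symm
  refine Finset.sum_bij (fun k _ => k.succPNat) ?_ ?_ ?_ (fun _ _ => rfl)
  · intro k hk
    simp only [Finset.mem_sdiff, Finset.mem_range] at hk
    rw [mem_window, Nat.succPNat_coe]
    have h1 : ⌈α * t⌉₊ ≤ k + 1 := by omega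
    refine ⟨by simpa using Nat.ceil_le.1 h1, ?_⟩
    have : k + 1 ≤ ⌊β * t⌋₊ := hk.1
    exact (Nat.le_floor_iff (hpos.le.trans hle)).1 this
  · intro k _ l _ h
    simpa using h
  · intro i hi
    rw [mem_window] at hi
    refine ⟨i.natPred, ?_, by simp⟩
    have hp := i.natPred_add_one
    have h1 : (i : ℕ) ≤ ⌊β * t⌋₊ := Nat.le_floor hi.2
    have h2 : ⌈α * t⌉₊ ≤ (i : ℕ) := Nat.ceil_le.2 hi.1
    simp only [Finset.mem_sdiff, Finset.mem_range]
    omega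

/-- After clearing the denominator, this bound and the next both reduce to (q - p)² ≥ 0 for
consecutive roots, since q² - p² = 1. Telescoping then pins the sum of 1/√k to 2√n up to a constant.
-/
theorem two_mul_sqrt_diff_le (n : ℕ) :
    2 * (√((n : ℝ) + 2) - √((n : ℝ) + 1)) ≤ 1 / √((n : ℝ) + 1) := by
  have h1 : (0 : ℝ) < n + 1 := by positivity
  have s1 := Real.sqrt_pos.2 h1
  rw [le_div_iff₀ s1]
  nlinarith [Real.sq_sqrt h1.le, Real.sq_sqrt (show (0 : ℝ) ≤ n + 2 by positivity),
    sq_nonneg (√((n : ℝ) + 2) - √((n : ℝ) + 1))]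

theorem le_two_mul_sqrt_diff (n : ℕ) :
    1 / √((n : ℝ) + 1) ≤ 2 * (√((n : ℝ) + 1) - √(n : ℝ)) := by
  have h1 : (0 : ℝ) < n + 1 := by positivity
  have s1 := Real.sqrt_pos.2 h1
  rw [div_le_iff₀ s1]
  nlinarith [Real.sq_sqrt h1.le, Real.sq_sqrt (show (0 : ℝ) ≤ n by positivity),
    sq_nonneg (√((n : ℝ) + 1) - √(n : ℝ))]

theorem sum_inv_sqrt_le (n : ℕ) :
    ∑ k ∈ Finset.range n, 1 / √((k : ℝ) + 1) ≤ 2 * √(n : ℝ) := by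
  induction n with
  | zero => simp
  | succ n ih =>
    rw [Finset.sum_range_succ]; push_cast
    linarith [le_two_mul_sqrt_diff n]

theorem le_sum_inv_sqrt (n : ℕ) :
    2 * √((n : ℝ) + 1) - 2 ≤ ∑ k ∈ Finset.range n, 1 / √((k : ℝ) + 1) := by
  induction n with
  | zero => simp
  | succ n ih =>
    rw [Finset.sum_range_succ]; push_cast
    have := two_mul_sqrt_diff_le n
    rw [show (n : ℝ) + 1 + 1 = n + 2 by ring]
    linarith

theorem tendsto_sqrt_natCast : Tendsto (fun n : ℕ => √(n : ℝ)) atTop atTop :=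
  Real.tendsto_sqrt_atTop.comp tendsto_natCast_atTop_atTop

theorem tendsto_sum_inv_sqrt_atTop :
    Tendsto (fun n : ℕ => ∑ k ∈ Finset.range n, 1 / √((k : ℝ) + 1)) atTop atTop := by
  refine tendsto_atTop_mono (fun n => ?_)
    (tendsto_atTop_add_const_right _ (-2) (tendsto_sqrt_natCast.const_mul_atTop two_pos))
  have := le_sum_inv_sqrt n
  have h : √(n : ℝ) ≤ √((n : ℝ) + 1) := Real.sqrt_le_sqrt (by linarith)
  linarith

theorem tendsto_sum_inv_sqrt_div :
    Tendsto (fun n : ℕ => (∑ k ∈ Finset.range n, 1 / √((k : ℝ) + 1)) / √(n : ℝ)) atTop (𝓝 2) := by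
  have h : Tendsto (fun n : ℕ => 2 - 2 / √(n : ℝ)) atTop (𝓝 2) := by
    simpa using (tendsto_sqrt_natCast.const_div_atTop 2).const_sub 2
  refine tendsto_of_tendsto_of_tendsto_of_le_of_le' h tendsto_const_nhds ?_ ?_
  · filter_upwards [eventually_gt_atTop 0] with n hn
    have s : 0 < √(n : ℝ) := Real.sqrt_pos.2 (by exact_mod_cast hn)
    rw [le_div_iff₀ s, sub_mul, div_mul_cancel₀ _ s.ne']
    have h : √(n : ℝ) ≤ √((n : ℝ) + 1) := Real.sqrt_le_sqrt (by linarith)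
    linarith [le_sum_inv_sqrt n]
  · filter_upwards [eventually_gt_atTop 0] with n hn
    have s : 0 < √(n : ℝ) := Real.sqrt_pos.2 (by exact_mod_cast hn)
    rw [div_le_iff₀ s]
    exact sum_inv_sqrt_le n

/-- Abel summation. The junk value 1/√0 = 0 is harmless, because it only ever multiplies an empty
sum. -/
theorem sum_div_sqrt_by_parts (z : ℕ → ℝ) (n : ℕ) :
    ∑ k ∈ Finset.range n, z k / √((k : ℝ) + 1) =
      (∑ k ∈ Finset.range n, z k) / √(n : ℝ) +
        ∑ k ∈ Finset.range n, (∑ l ∈ Finset.range k, z l) * (1 / √(k : ℝ) - 1 / √((k : ℝ) + 1)) := by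
  induction n with
  | zero => simp
  | succ n ih =>
    rw [Finset.sum_range_succ, ih, Finset.sum_range_succ _ n, Finset.sum_range_succ _ n]
    push_cast
    ring

theorem inv_sqrt_diff_le {k : ℕ} (hk : 0 < k) :
    (k : ℝ) * (1 / √(k : ℝ) - 1 / √((k : ℝ) + 1)) ≤ 1 / √((k : ℝ) + 1) := by
  have h0 : (0 : ℝ) < k := by exact_mod_cast hk
  have s0 := Real.sqrt_pos.2 h0
  have s1 := Real.sqrt_pos.2 (show (0 : ℝ) < k + 1 by positivity)
  have q0 := Real.sq_sqrt h0.le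
  have q1 := Real.sq_sqrt (show (0 : ℝ) ≤ k + 1 by positivity)
  set p := √(k : ℝ)
  set q := √((k : ℝ) + 1)
  have hpq : p ≤ q := Real.sqrt_le_sqrt (by linarith)
  rw [← q0, div_sub_div _ _ s0.ne' s1.ne', mul_div_assoc', div_le_div_iff₀ (by positivity) s1]
  have : p ^ 2 * (1 * q - p * 1) ≤ p := by nlinarith
  nlinarith [mul_le_mul_of_nonneg_right this s1.le]

/-- If the averages of `z` tend to zero, then `∑_{k ≤ n} z_k / √k = o(√n)`. -/
theorem tendsto_sum_div_sqrt_of_zero {z : ℕ → ℝ}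
    (h : Tendsto (fun n : ℕ => (∑ k ∈ Finset.range n, z k) / n) atTop (𝓝 0)) :
    Tendsto (fun n : ℕ => (∑ k ∈ Finset.range n, z k / √((k : ℝ) + 1)) / √(n : ℝ))
      atTop (𝓝 0) := by
  -- The partial sums of `z` are o(k) and the increments of 1/√k are O(k^(-3/2)), so each term is
  -- o(1/√k). The comparison series diverges, so the little-o passes to partial sums.
  have key : (fun k : ℕ => (∑ l ∈ Finset.range k, z l) * (1 / √(k : ℝ) - 1 / √((k : ℝ) + 1)))
      =o[atTop] fun k : ℕ => 1 / √((k : ℝ) + 1) := by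
    rw [Asymptotics.isLittleO_iff]
    intro c hc
    filter_upwards [(Metric.tendsto_nhds.1 h) c hc, eventually_gt_atTop 0] with k hk hk0
    have h0 : (0 : ℝ) < k := by exact_mod_cast hk0
    rw [Real.dist_eq, sub_zero, abs_div, abs_of_pos h0, div_lt_iff₀ h0] at hk
    have hd : 0 ≤ 1 / √(k : ℝ) - 1 / √((k : ℝ) + 1) :=
      sub_nonneg.2 (one_div_le_one_div_of_le (Real.sqrt_pos.2 h0) (Real.sqrt_le_sqrt (by linarith)))
    rw [Real.norm_eq_abs, abs_mul, abs_of_nonneg hd, Real.norm_of_nonneg (by positivity)]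
    calc _ ≤ c * k * (1 / √(k : ℝ) - 1 / √((k : ℝ) + 1)) := by gcongr
      _ = c * (k * (1 / √(k : ℝ) - 1 / √((k : ℝ) + 1))) := by ring
      _ ≤ _ := by gcongr; exact inv_sqrt_diff_le hk0
  have h2 := (key.sum_range (fun _ => by positivity) tendsto_sum_inv_sqrt_atTop).tendsto_div_nhds_zero
  have h3 := h2.mul tendsto_sum_inv_sqrt_div
  rw [zero_mul] at h3
  have h4 := h.add h3
  rw [add_zero] at h4
  refine h4.congr' ?_
  filter_upwards [eventually_gt_atTop 0] with n hn
  have h0 : (0 : ℝ) < n := by exact_mod_cast hn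
  have s : 0 < √(n : ℝ) := Real.sqrt_pos.2 h0
  have s' : 0 < ∑ k ∈ Finset.range n, 1 / √((k : ℝ) + 1) :=
    Finset.sum_pos (fun k _ => by positivity) (by simpa using hn.ne')
  rw [sum_div_sqrt_by_parts z n, div_mul_div_cancel₀ s'.ne', add_div, div_div, Real.mul_self_sqrt h0.le]

/-- Split z = (z - m) + m: the centred part is negligible and the constant part is explicit. -/
theorem CesaroTendsto.tendsto_sum_div_sqrt {z : ℕ+ → ℝ} {m : ℝ} (h : CesaroTendsto z m) :
    Tendsto (fun n : ℕ => (∑ k ∈ Finset.range n, z k.succPNat / √((k.succPNat : ℕ+) : ℝ)) / √(n : ℝ))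
      atTop (𝓝 (2 * m)) := by
  have h1 : Tendsto (fun n : ℕ => (∑ k ∈ Finset.range n, (z k.succPNat - m)) / n) atTop (𝓝 0) := by
    have := h.sub_const m
    rw [sub_self] at this
    refine this.congr' ?_
    filter_upwards [eventually_gt_atTop 0] with n hn
    have h0 : (n : ℝ) ≠ 0 := by exact_mod_cast hn.ne'
    rw [Finset.sum_sub_distrib, Finset.sum_const, Finset.card_range, nsmul_eq_mul, sub_div,
      mul_div_cancel_left₀ _ h0]
  have h2 := (tendsto_sum_div_sqrt_of_zero h1).add (tendsto_sum_inv_sqrt_div.mul_const m)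
  rw [zero_add] at h2
  refine h2.congr fun n => ?_
  rw [div_mul_eq_mul_div, ← add_div, Finset.sum_mul, ← Finset.sum_add_distrib]
  congr 1
  refine Finset.sum_congr rfl fun k _ => ?_
  simp only [Nat.succPNat_coe, Nat.cast_succ]
  ring

theorem tendsto_pnatCast : Tendsto (fun t : ℕ+ => (t : ℝ)) atTop atTop :=
  tendsto_natCast_atTop_atTop.comp tendsto_PNat_val_atTop_atTop

theorem tendsto_sum_div_sqrt_comp {F : ℕ → ℝ} {c : ℝ}
    (hF : Tendsto (fun n : ℕ => F n / √(n : ℝ)) atTop (𝓝 c)) {N : ℕ+ → ℕ} {α : ℝ} (hα : 0 < α)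
    (hN : Tendsto (fun t : ℕ+ => (N t : ℝ) / t) atTop (𝓝 α)) :
    Tendsto (fun t : ℕ+ => F (N t) / √(t : ℝ)) atTop (𝓝 (c * √α)) := by
  have hN' : Tendsto N atTop atTop := by
    rw [← tendsto_natCast_atTop_iff (R := ℝ)]
    refine (hN.pos_mul_atTop hα tendsto_pnatCast).congr fun t => ?_
    have : (t : ℝ) ≠ 0 := by exact_mod_cast t.ne_zero
    field_simp
  have h1 := (hF.comp hN').mul ((Real.continuous_sqrt.tendsto α).comp hN)
  refine h1.congr' ?_
  filter_upwards [hN'.eventually_gt_atTop 0] with t ht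
  have : √(N t : ℝ) ≠ 0 := (Real.sqrt_pos.2 (by exact_mod_cast ht)).ne'
  simp only [Function.comp]
  rw [Real.sqrt_div (by positivity), div_mul_div_cancel₀ this]

/-- A Riemann-sum statement: the constant is the integral of s^(-1/2) over [α, β]. With (a, b) it
gives the factor in λ₁, and with (1/b, 1/a) the factor in λ₂. -/
theorem CesaroTendsto.tendsto_sum_window {z : ℕ+ → ℝ} {m : ℝ} (h : CesaroTendsto z m)
    {α β : ℝ} (hα : 0 < α) (hab : α ≤ β) :
    Tendsto (fun t : ℕ+ => ∑ i ∈ window α β t, z i / √((i : ℝ) * t)) atTop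
      (𝓝 (2 * (√β - √α) * m)) := by
  have hβ := hα.trans_le hab
  have h1 := tendsto_sum_div_sqrt_comp h.tendsto_sum_div_sqrt (N := fun t => ⌊β * t⌋₊) hβ
    ((tendsto_nat_floor_mul_div_atTop hβ.le).comp tendsto_pnatCast)
  have h2 := tendsto_sum_div_sqrt_comp h.tendsto_sum_div_sqrt (N := fun t => ⌈α * t⌉₊ - 1) hα (by
    have := ((tendsto_nat_ceil_mul_div_atTop hα.le).comp tendsto_pnatCast).sub
      (tendsto_pnatCast.const_div_atTop 1)
    rw [sub_zero] at this
    refine this.congr fun t => ?_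
    have ht : (0 : ℝ) < t := by exact_mod_cast t.pos
    have : 1 ≤ ⌈α * t⌉₊ := Nat.one_le_iff_ne_zero.2 (Nat.ceil_pos.2 (by positivity)).ne'
    simp only [Function.comp]
    rw [Nat.cast_sub this, Nat.cast_one, sub_div])
  have h3 := h1.sub h2
  rw [show 2 * m * √β - 2 * m * √α = 2 * (√β - √α) * m by ring] at h3
  refine h3.congr fun t => ?_
  rw [← sub_div, ← sum_window hα hab t (fun i => z i / √(i : ℝ)), Finset.sum_div]
  refine Finset.sum_congr rfl fun i _ => ?_
  rw [Real.sqrt_mul (by positivity), div_div]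

/-- A single term is the difference of two consecutive partial sums, and both have the same
normalized limit. -/
theorem CesaroTendsto.tendsto_div {z : ℕ+ → ℝ} {m : ℝ} (h : CesaroTendsto z m) :
    Tendsto (fun i : ℕ+ => z i / i) atTop (𝓝 0) := by
  have h1 : Tendsto (fun n : ℕ => (n : ℝ) / (n + 1)) atTop (𝓝 1) :=
    tendsto_natCast_div_add_atTop 1
  have h2 := ((tendsto_add_atTop_iff_nat 1).2 h).sub (h.mul h1)
  rw [mul_one, sub_self] at h2
  have h3 : Tendsto (fun i : ℕ+ => i.natPred) atTop atTop := by
    exact (tendsto_sub_atTop_nat 1).comp tendsto_PNat_val_atTop_atTop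
  refine (h2.comp h3).congr fun i => ?_
  have hi : ((i.natPred : ℕ) : ℝ) + 1 = i := by exact_mod_cast i.natPred_add_one
  simp only [Function.comp]
  rcases Nat.eq_zero_or_pos i.natPred with h0 | h0
  · have h0' : i = 1 := by rw [← PNat.succPNat_natPred i, h0]; rfl
    subst h0'
    simp [h0]
    rfl
  · have : (i.natPred : ℝ) ≠ 0 := by exact_mod_cast h0.ne'
    rw [div_mul_div_cancel₀ this, Nat.cast_add, Nat.cast_one, hi, ← sub_div, Finset.sum_range_succ,
      add_sub_cancel_left, PNat.succPNat_natPred]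

theorem eventually_forall_mem_window {p : ℕ+ → Prop} (hp : ∀ᶠ i in atTop, p i) {α : ℝ} (hα : 0 < α)
    (β : ℝ) : ∀ᶠ t : ℕ+ in atTop, ∀ i ∈ window α β t, p i := by
  obtain ⟨N, hN⟩ := eventually_atTop.1 hp
  filter_upwards [tendsto_pnatCast.eventually_ge_atTop (N / α)] with t ht i hi
  refine hN i ?_
  rw [div_le_iff₀' hα] at ht
  have := ht.trans (mem_window.1 hi).1
  exact_mod_cast this

/-- The lower edge of the window goes to infinity, so `ε` is uniformly small on it while the
remaining sum stays bounded. -/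
theorem CesaroTendsto.tendsto_sum_window_mul_zero {f ε : ℕ+ → ℝ} {m : ℝ} (h : CesaroTendsto f m)
    (hf : ∀ i, 0 ≤ f i) (hε : Tendsto ε atTop (𝓝 0)) {α β : ℝ} (hα : 0 < α) (hab : α ≤ β) :
    Tendsto (fun t : ℕ+ => ∑ i ∈ window α β t, f i * ε i / √((i : ℝ) * t)) atTop (𝓝 0) := by
  have hS := h.tendsto_sum_window hα hab
  set L := 2 * (√β - √α) * m
  rw [Metric.tendsto_nhds]
  intro e he
  set δ := e / (|L| + 1)
  have hL : 0 < |L| + 1 := by positivity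
  have hδ : 0 < δ := by positivity
  filter_upwards [hS.eventually_lt_const (show L < |L| + 1 by linarith [le_abs_self L]),
    eventually_forall_mem_window ((Metric.tendsto_nhds.1 hε) δ hδ) hα β] with t ht hw
  rw [Real.dist_eq, sub_zero]
  calc |∑ i ∈ window α β t, f i * ε i / √((i : ℝ) * t)|
      ≤ ∑ i ∈ window α β t, |f i * ε i / √((i : ℝ) * t)| := Finset.abs_sum_le_sum_abs _ _
    _ ≤ ∑ i ∈ window α β t, δ * (f i / √((i : ℝ) * t)) := by
        refine Finset.sum_le_sum fun i hi => ?_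
        have h1 := hw i hi
        rw [Real.dist_eq, sub_zero] at h1
        rw [abs_div, abs_mul, abs_of_nonneg (hf i), abs_of_nonneg (Real.sqrt_nonneg _),
          mul_div_assoc', mul_comm δ]
        have := hf i
        gcongr
    _ = δ * ∑ i ∈ window α β t, f i / √((i : ℝ) * t) := by rw [Finset.mul_sum]
    _ < δ * (|L| + 1) := by gcongr
    _ = e := by simp only [δ]; field_simp

theorem inv_sqrt_le_of_mem_window {α β : ℝ} (hβ : 0 < β) {t i : ℕ+} (hi : i ∈ window α β t) :
    1 / √((i : ℝ) * t) ≤ √β / i := by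
  have h0 : (0 : ℝ) < i := by exact_mod_cast i.pos
  have ht : (0 : ℝ) < t := by exact_mod_cast t.pos
  rw [div_le_div_iff₀ (Real.sqrt_pos.2 (by positivity)) h0, one_mul, ← Real.sqrt_mul hβ.le]
  refine Real.le_sqrt_of_sq_le ?_
  nlinarith [(mem_window.1 hi).2]

/-- No second moment is needed: one of the two factors is at most √β · y_i / i, which tends to 0,
and the other is summed as before. -/
theorem CesaroTendsto.tendsto_sum_window_sq {y : ℕ+ → ℝ} {m : ℝ} (h : CesaroTendsto y m)
    (hy : ∀ i, 0 ≤ y i) {α β : ℝ} (hα : 0 < α) (hab : α ≤ β) :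
    Tendsto (fun t : ℕ+ => ∑ i ∈ window α β t, (y i / √((i : ℝ) * t)) ^ 2) atTop (𝓝 0) := by
  have hβ := hα.trans_le hab
  have h1 : Tendsto (fun i : ℕ+ => √β * (y i / i)) atTop (𝓝 0) := by
    simpa using h.tendsto_div.const_mul (√β)
  refine squeeze_zero (fun t => by positivity) (fun t => ?_)
    (h.tendsto_sum_window_mul_zero hy h1 hα hab)
  refine Finset.sum_le_sum fun i hi => ?_
  have h2 := inv_sqrt_le_of_mem_window hβ hi
  have := hy i
  calc (y i / √((i : ℝ) * t)) ^ 2 = y i / √((i : ℝ) * t) * (y i * (1 / √((i : ℝ) * t))) := by ring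
    _ ≤ y i / √((i : ℝ) * t) * (y i * (√β / i)) := by gcongr
    _ = _ := by ring

/-! ### Poisson approximation of products -/

/-- Exchange the factors one at a time; every untouched factor has absolute value at most 1. -/
theorem abs_prod_sub_prod_le {ι : Type*} (s : Finset ι) (f g : ι → ℝ)
    (hf : ∀ i ∈ s, |f i| ≤ 1) (hg : ∀ i ∈ s, |g i| ≤ 1) :
    |∏ i ∈ s, f i - ∏ i ∈ s, g i| ≤ ∑ i ∈ s, |f i - g i| := by
  classical
  induction s using Finset.induction_on with
  | empty => simp
  | insert i s his ih =>
    rw [Finset.prod_insert his, Finset.prod_insert his, Finset.sum_insert his]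
    have h1 : |∏ i ∈ s, f i| ≤ 1 := by
      rw [Finset.abs_prod]
      exact Finset.prod_le_one (fun _ _ => abs_nonneg _)
        fun j hj => hf j (Finset.mem_insert_of_mem hj)
    have h2 := ih (fun j hj => hf j (Finset.mem_insert_of_mem hj))
      (fun j hj => hg j (Finset.mem_insert_of_mem hj))
    have h3 := hg i (Finset.mem_insert_self _ _)
    calc |f i * ∏ i ∈ s, f i - g i * ∏ i ∈ s, g i|
        = |(f i - g i) * ∏ i ∈ s, f i + g i * (∏ i ∈ s, f i - ∏ i ∈ s, g i)| := by ring_nf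
      _ ≤ |f i - g i| * |∏ i ∈ s, f i| + |g i| * |∏ i ∈ s, f i - ∏ i ∈ s, g i| := by
          rw [← abs_mul, ← abs_mul]; exact abs_add_le _ _
      _ ≤ |f i - g i| * 1 + 1 * ∑ i ∈ s, |f i - g i| := by gcongr
      _ = _ := by ring

theorem abs_prod_one_sub_sub_exp_le {ι : Type*} (s : Finset ι) (v : ι → ℝ)
    (hv : ∀ i ∈ s, 0 ≤ v i ∧ v i ≤ 1) :
    |∏ i ∈ s, (1 - v i) - Real.exp (-∑ i ∈ s, v i)| ≤ ∑ i ∈ s, v i ^ 2 := by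
  rw [← Finset.sum_neg_distrib, Real.exp_sum]
  refine (abs_prod_sub_prod_le s _ _ ?_ ?_).trans (Finset.sum_le_sum fun i hi => ?_)
  · intro i hi
    have := hv i hi
    rw [abs_le]; constructor <;> linarith
  · intro i hi
    rw [abs_of_pos (Real.exp_pos _), Real.exp_le_one_iff]
    linarith [(hv i hi).1]
  · have := hv i hi
    have h := Real.abs_exp_sub_one_sub_id_le (x := -v i) (by
      rw [abs_neg, abs_of_nonneg this.1]; exact this.2)
    rw [neg_sq] at h
    rw [abs_sub_comm]
    rwa [show Real.exp (-v i) - (1 - v i) = Real.exp (-v i) - 1 - -v i by ring]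

theorem abs_exp_neg_sub_exp_neg_le {A B : ℝ} (hA : 0 ≤ A) (hB : 0 ≤ B) :
    |Real.exp (-A) - Real.exp (-B)| ≤ |A - B| := by
  wlog h : A ≤ B generalizing A B
  · rw [abs_sub_comm, abs_sub_comm A]
    exact this hB hA (le_of_not_ge h)
  have h1 : Real.exp (-B) ≤ Real.exp (-A) := Real.exp_le_exp.2 (by linarith)
  rw [abs_of_nonneg (by linarith), abs_of_nonpos (by linarith)]
  have h2 : Real.exp (-A) * Real.exp (-(B - A)) = Real.exp (-B) := by
    rw [← Real.exp_add]; congr 1; ring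
  have h3 := Real.add_one_le_exp (-(B - A))
  have h4 : Real.exp (-A) ≤ 1 := Real.exp_le_one_iff.2 (by linarith)
  nlinarith [Real.exp_pos (-A)]

theorem sub_min_one_le_sq {x : ℝ} : |min 1 x - x| ≤ x ^ 2 := by
  rcases le_total x 1 with h | h
  · rw [min_eq_right h, sub_self, abs_zero]; positivity
  · rw [min_eq_left h, abs_of_nonpos (by linarith)]; nlinarith

/-- The point is a bound linear in `x`. The direct estimate is quadratic, D ≤ 2x²∑w², but also D ≤
1, hence D² ≤ D and a square root may be taken. Later this error is multiplied by another factor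
x_i, so only a second moment of the item weights is used. -/
theorem abs_prod_one_sub_min_sub_exp_le {ι : Type*} (J : Finset ι) (w : ι → ℝ) (hw : ∀ j, 0 ≤ w j)
    {x u : ℝ} (hx : 0 ≤ x) (hu : 0 ≤ u) (hu1 : u ≤ 1) :
    |∏ j ∈ J, (1 - u * min 1 (x * w j)) - Real.exp (-(u * (x * ∑ j ∈ J, w j)))| ≤
      x * √(2 * ∑ j ∈ J, w j ^ 2) := by
  have hq0 : ∀ j, 0 ≤ min 1 (x * w j) := fun j => le_min zero_le_one (mul_nonneg hx (hw j))
  have hq1 : ∀ j, min 1 (x * w j) ≤ 1 := fun j => min_le_left _ _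
  have hv : ∀ j, 0 ≤ u * min 1 (x * w j) ∧ u * min 1 (x * w j) ≤ 1 :=
    fun j => ⟨mul_nonneg hu (hq0 j), mul_le_one₀ hu1 (hq0 j) (hq1 j)⟩
  have hqx : ∀ j, min 1 (x * w j) ≤ x * w j := fun j => min_le_right _ _
  have hW : 0 ≤ ∑ j ∈ J, w j := Finset.sum_nonneg fun j _ => hw j
  set D := |∏ j ∈ J, (1 - u * min 1 (x * w j)) - Real.exp (-(u * (x * ∑ j ∈ J, w j)))|
  have hD1 : D ≤ 1 := by
    have h1 : 0 ≤ ∏ j ∈ J, (1 - u * min 1 (x * w j)) :=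
      Finset.prod_nonneg fun j _ => by linarith [(hv j).2]
    have h2 : ∏ j ∈ J, (1 - u * min 1 (x * w j)) ≤ 1 :=
      Finset.prod_le_one (fun j _ => by linarith [(hv j).2]) fun j _ => by linarith [(hv j).1]
    have h3 := Real.exp_pos (-(u * (x * ∑ j ∈ J, w j)))
    have h4 : Real.exp (-(u * (x * ∑ j ∈ J, w j))) ≤ 1 :=
      Real.exp_le_one_iff.2 (neg_nonpos.2 (by positivity))
    exact abs_le.2 ⟨by linarith, by linarith⟩
  have hD2 : D ≤ 2 * x ^ 2 * ∑ j ∈ J, w j ^ 2 := by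
    have h1 := abs_prod_one_sub_sub_exp_le J (fun j => u * min 1 (x * w j)) fun j _ => hv j
    have h2 := abs_exp_neg_sub_exp_neg_le (A := ∑ j ∈ J, u * min 1 (x * w j))
      (B := u * (x * ∑ j ∈ J, w j)) (Finset.sum_nonneg fun j _ => (hv j).1) (by positivity)
    have h3 : ∑ j ∈ J, (u * min 1 (x * w j)) ^ 2 ≤ x ^ 2 * ∑ j ∈ J, w j ^ 2 := by
      rw [Finset.mul_sum]
      refine Finset.sum_le_sum fun j _ => ?_
      rw [← mul_pow]
      have : u * min 1 (x * w j) ≤ x * w j :=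
        (mul_le_of_le_one_left (hq0 j) hu1).trans (hqx j)
      exact pow_le_pow_left₀ (hv j).1 this 2
    have h4 : |∑ j ∈ J, u * min 1 (x * w j) - u * (x * ∑ j ∈ J, w j)| ≤
        x ^ 2 * ∑ j ∈ J, w j ^ 2 := by
      rw [Finset.mul_sum, Finset.mul_sum, ← Finset.sum_sub_distrib, Finset.mul_sum]
      refine (Finset.abs_sum_le_sum_abs _ _).trans (Finset.sum_le_sum fun j _ => ?_)
      rw [← mul_sub, abs_mul, abs_of_nonneg hu, ← mul_pow]
      exact (mul_le_of_le_one_left (abs_nonneg _) hu1).trans sub_min_one_le_sq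
    calc D ≤ _ := abs_sub_le _ (Real.exp (-∑ j ∈ J, u * min 1 (x * w j))) _
      _ ≤ x ^ 2 * ∑ j ∈ J, w j ^ 2 + x ^ 2 * ∑ j ∈ J, w j ^ 2 :=
        add_le_add (h1.trans h3) (h2.trans h4)
      _ = _ := by ring
  have hD0 : 0 ≤ D := abs_nonneg _
  rw [← Real.sqrt_sq hx, ← Real.sqrt_mul (sq_nonneg x)]
  refine Real.le_sqrt_of_sq_le ?_
  nlinarith

/-- Two corrections to the previous estimate: the omitted index costs w_t ≤ √∑w², and the actual sum
is replaced by its limit `c`. -/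
theorem abs_prod_erase_sub_exp_le {ι : Type*} [DecidableEq ι] (J : Finset ι) (w : ι → ℝ)
    (hw : ∀ j, 0 ≤ w j) {t : ι} (ht : t ∈ J) {x u c : ℝ} (hx : 0 ≤ x) (hu : 0 ≤ u) (hu1 : u ≤ 1)
    (hc : 0 ≤ c) :
    |∏ j ∈ J.erase t, (1 - u * min 1 (x * w j)) - Real.exp (-(u * (x * c)))| ≤
      x * (√(2 * ∑ j ∈ J, w j ^ 2) + √(∑ j ∈ J, w j ^ 2) + |∑ j ∈ J, w j - c|) := by
  have h1 := abs_prod_one_sub_min_sub_exp_le (J.erase t) w hw hx hu hu1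
  have hW : 0 ≤ ∑ j ∈ J.erase t, w j := Finset.sum_nonneg fun j _ => hw j
  have h2 := abs_exp_neg_sub_exp_neg_le (A := u * (x * ∑ j ∈ J.erase t, w j))
      (B := u * (x * c)) (by positivity) (by positivity)
  have h3 : √(2 * ∑ j ∈ J.erase t, w j ^ 2) ≤ √(2 * ∑ j ∈ J, w j ^ 2) := by
    gcongr
    exact Finset.erase_subset _ _
  have h4 : w t ≤ √(∑ j ∈ J, w j ^ 2) :=
    Real.le_sqrt_of_sq_le (Finset.single_le_sum (f := fun j => w j ^ 2) (fun j _ => sq_nonneg _) ht)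
  have h5 : |u * (x * ∑ j ∈ J.erase t, w j) - u * (x * c)| ≤
      x * (√(∑ j ∈ J, w j ^ 2) + |∑ j ∈ J, w j - c|) := by
    rw [← mul_sub, ← mul_sub, abs_mul, abs_mul, abs_of_nonneg hu, abs_of_nonneg hx]
    refine (mul_le_of_le_one_left (by positivity) hu1).trans ?_
    gcongr
    have h6 := Finset.add_sum_erase J w ht
    rw [show ∑ j ∈ J.erase t, w j - c = (∑ j ∈ J, w j - c) - w t by rw [← h6]; ring]
    refine (abs_sub _ _).trans ?_
    rw [abs_of_nonneg (hw t)]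
    linarith
  refine (abs_sub_le _ _ _).trans ((add_le_add h1 (h2.trans h5)).trans ?_)
  have := mul_le_mul_of_nonneg_left h3 hx
  linarith

/-! ### Conditional generating function and 4-cycles for fixed weights -/

theorem edgeProb_nonneg {a b : ℝ} {τ : ℕ+ → ℝ} {x y : ℝ} (hx : 0 ≤ x) (hy : 0 ≤ y) (i j : ℕ+) :
    0 ≤ edgeProb a b τ x y i j := by
  unfold edgeProb
  split_ifs
  · exact le_min zero_le_one (by positivity)
  · exact le_rfl

theorem edgeProb_le_one (a b : ℝ) (τ : ℕ+ → ℝ) (x y : ℝ) (i j : ℕ+) :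
    edgeProb a b τ x y i j ≤ 1 := by
  unfold edgeProb
  split_ifs
  · exact min_le_left _ _
  · exact zero_le_one

theorem edgeProb_le {a b : ℝ} {τ : ℕ+ → ℝ} {x y : ℝ} (hx : 0 ≤ x) (hy : 0 ≤ y) (i j : ℕ+) :
    edgeProb a b τ x y i j ≤ x * (y / √((i : ℝ) * j)) := by
  unfold edgeProb
  rw [mul_div_assoc']
  split_ifs
  · exact min_le_right _ _
  · positivity

theorem edgeProb_of_mem_window {a b : ℝ} {i j : ℕ+} (h : i ∈ window a b j) (x y : ℝ) :
    edgeProb a b (fun t => (t : ℝ)) x y i j = min 1 (x * (y / √((i : ℝ) * j))) := by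
  unfold edgeProb
  rw [if_pos (mem_window.1 h), mul_div_assoc']

theorem edgeProb_of_notMem_window {a b : ℝ} {i j : ℕ+} (h : i ∉ window a b j) (x y : ℝ) :
    edgeProb a b (fun t => (t : ℝ)) x y i j = 0 := by
  unfold edgeProb
  rw [if_neg (fun h' => h (mem_window.2 h'))]

theorem mem_window_inv {a b : ℝ} (ha : 0 < a) (hb : 0 < b) {i j : ℕ+} :
    j ∈ window b⁻¹ a⁻¹ i ↔ i ∈ window a b j := by
  rw [mem_window, mem_window, inv_mul_le_iff₀ hb, le_inv_mul_iff₀ ha, and_comm]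

/-- The conditional probability generating function at `1 - u`, given the weights `x` and `y`, of
the number of pairs of edges `{v_t, w_i}, {w_i, v_j}` with `j ≠ t`. -/
noncomputable def weightPGF (a b u : ℝ) (t : ℕ+) (x y : ℕ+ → ℝ) : ℝ :=
  ∏ i ∈ window a b t, (1 - edgeProb a b (fun t => (t : ℝ)) (x i) (y t) i t *
    (1 - ∏ j ∈ (window b⁻¹ a⁻¹ i).erase t,
      (1 - u * edgeProb a b (fun t => (t : ℝ)) (x i) (y j) i j)))

theorem weightPGF_inner_mem {a b u : ℝ} (hu : 0 ≤ u) (hu1 : u ≤ 1) {x y : ℕ+ → ℝ}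
    (hx : ∀ i, 0 ≤ x i) (hy : ∀ j, 0 ≤ y j) (i : ℕ+) (J : Finset ℕ+) :
    0 ≤ 1 - ∏ j ∈ J, (1 - u * edgeProb a b (fun t => (t : ℝ)) (x i) (y j) i j) ∧
    1 - ∏ j ∈ J, (1 - u * edgeProb a b (fun t => (t : ℝ)) (x i) (y j) i j) ≤ 1 := by
  have h (j : ℕ+) : 0 ≤ 1 - u * edgeProb a b (fun t => (t : ℝ)) (x i) (y j) i j :=
    sub_nonneg.2 (mul_le_one₀ hu1 (edgeProb_nonneg (hx i) (hy j) i j) (edgeProb_le_one ..))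
  constructor
  · exact sub_nonneg.2 (Finset.prod_le_one (fun j _ => h j) fun j _ =>
      sub_le_self _ (mul_nonneg hu (edgeProb_nonneg (hx i) (hy j) i j)))
  · exact sub_le_self _ (Finset.prod_nonneg fun j _ => h j)

theorem weightPGF_mem {a b u : ℝ} (hu : 0 ≤ u) (hu1 : u ≤ 1) {x y : ℕ+ → ℝ}
    (hx : ∀ i, 0 ≤ x i) (hy : ∀ j, 0 ≤ y j) (t : ℕ+) :
    0 ≤ weightPGF a b u t x y ∧ weightPGF a b u t x y ≤ 1 := by
  have h (i : ℕ+) := weightPGF_inner_mem (a := a) (b := b) hu hu1 hx hy i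
    ((window b⁻¹ a⁻¹ i).erase t)
  have hp (i : ℕ+) := edgeProb_nonneg (a := a) (b := b) (τ := fun t => (t : ℝ)) (hx i) (hy t) i t
  constructor
  · exact Finset.prod_nonneg fun i _ => sub_nonneg.2
      (mul_le_one₀ (edgeProb_le_one ..) (h i).1 (h i).2)
  · exact Finset.prod_le_one (fun i _ => sub_nonneg.2
      (mul_le_one₀ (edgeProb_le_one ..) (h i).1 (h i).2)) fun i _ =>
      sub_le_self _ (mul_nonneg (hp i) (h i).1)

/-- The product over j skips j = t, so it does not see the overwritten weight and is within x_i ε_i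
of exp(-u x_i c), where ε_i → 0 does not depend on t. The product over i is then a Poisson
approximation with mean y₀ ∑ x_i g_i / √(i t). -/
theorem tendsto_weightPGF_update {a b u : ℝ} (ha : 0 < a) (hab : a ≤ b) (hu : 0 ≤ u) (hu1 : u ≤ 1)
    {x y : ℕ+ → ℝ} (hx : ∀ i, 0 ≤ x i) (hy : ∀ j, 0 ≤ y j) {m₂ b₁ z : ℝ} (hb₁ : 0 ≤ b₁)
    (hx2 : CesaroTendsto (fun i => x i ^ 2) m₂) (hyc : CesaroTendsto y b₁)
    (hz : CesaroTendsto (fun i => x i * (1 - Real.exp (-(u * (x i * (2 * (√a⁻¹ - √b⁻¹) * b₁)))))) z)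
    {y₀ : ℝ} (hy₀ : 0 ≤ y₀) :
    Tendsto (fun t => weightPGF a b u t x (Function.update y t y₀)) atTop
      (𝓝 (Real.exp (-(y₀ * (2 * (√b - √a) * z))))) := by
  have hb := ha.trans_le hab
  have hinv : b⁻¹ ≤ a⁻¹ := inv_anti₀ ha hab
  have hbi : 0 < b⁻¹ := inv_pos.2 hb
  set c := 2 * (√a⁻¹ - √b⁻¹) * b₁
  have hc : 0 ≤ c := by
    have := Real.sqrt_le_sqrt hinv
    exact mul_nonneg (by linarith) hb₁
  set g : ℕ+ → ℝ := fun i => 1 - Real.exp (-(u * (x i * c)))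
  set w : ℕ+ → ℕ+ → ℝ := fun i j => y j / √((i : ℝ) * j)
  have hw : ∀ i j, 0 ≤ w i j := fun i j => div_nonneg (hy j) (Real.sqrt_nonneg _)
  set J : ℕ+ → Finset ℕ+ := fun i => window b⁻¹ a⁻¹ i
  set ε : ℕ+ → ℝ := fun i => √(2 * ∑ j ∈ J i, w i j ^ 2) + √(∑ j ∈ J i, w i j ^ 2) +
    |∑ j ∈ J i, w i j - c|
  have hε : Tendsto ε atTop (𝓝 0) := by
    have hη : Tendsto (fun i => ∑ j ∈ J i, w i j ^ 2) atTop (𝓝 0) := by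
      simpa only [w, mul_comm] using hyc.tendsto_sum_window_sq hy hbi hinv
    have hW : Tendsto (fun i => ∑ j ∈ J i, w i j) atTop (𝓝 c) := by
      refine (hyc.tendsto_sum_window hbi hinv).congr fun i => Finset.sum_congr rfl fun j _ => ?_
      rw [mul_comm (j : ℝ)]
    have h1 := (Real.continuous_sqrt.tendsto _).comp (hη.const_mul 2)
    have h2 := (Real.continuous_sqrt.tendsto _).comp hη
    have h3 := (hW.sub_const c).abs
    have h4 := (h1.add h2).add h3
    simp only [mul_zero, Real.sqrt_zero, sub_self, abs_zero, add_zero] at h4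
    exact h4
  have hlim : Tendsto (fun t : ℕ+ => ∑ i ∈ window a b t, x i * g i / √((i : ℝ) * t)) atTop
      (𝓝 (2 * (√b - √a) * z)) := hz.tendsto_sum_window ha hab
  have herr1 : Tendsto (fun t : ℕ+ => ∑ i ∈ window a b t, x i ^ 2 * ε i / √((i : ℝ) * t)) atTop
      (𝓝 0) := hx2.tendsto_sum_window_mul_zero (fun i => sq_nonneg _) hε ha hab
  have herr2 : Tendsto (fun t : ℕ+ => ∑ i ∈ window a b t, x i ^ 2 * (√b / i) / √((i : ℝ) * t)) atTop
      (𝓝 0) := hx2.tendsto_sum_window_mul_zero (fun i => sq_nonneg _)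
        (tendsto_pnatCast.const_div_atTop _) ha hab
  have hmain : Tendsto (fun t : ℕ+ => Real.exp (-(y₀ *
      ∑ i ∈ window a b t, x i * g i / √((i : ℝ) * t)))) atTop
      (𝓝 (Real.exp (-(y₀ * (2 * (√b - √a) * z))))) :=
    (Real.continuous_exp.tendsto _).comp (hlim.const_mul y₀).neg
  -- The factor 2 collects the quadratic error of the Poisson approximation and that of removing the
  -- minimum with 1; the second sum is the error made inside each item.
  have herr : Tendsto (fun t : ℕ+ =>
      2 * y₀ ^ 2 * ∑ i ∈ window a b t, x i ^ 2 * (√b / i) / √((i : ℝ) * t) +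
        y₀ * ∑ i ∈ window a b t, x i ^ 2 * ε i / √((i : ℝ) * t)) atTop (𝓝 0) := by
    simpa using (herr2.const_mul (2 * y₀ ^ 2)).add (herr1.const_mul y₀)
  refine tendsto_of_tendsto_of_dist hmain (squeeze_zero (fun _ => dist_nonneg) (fun t => ?_) herr)
  rw [dist_comm, Real.dist_eq]
  set I := window a b t
  set r : ℕ+ → ℝ := fun i => 1 / √((i : ℝ) * t)
  have hr : ∀ i, 0 ≤ r i := fun i => by positivity
  set p : ℕ+ → ℝ := fun i => min 1 (x i * (y₀ * r i))
  set h : ℕ+ → ℝ := fun i => 1 - ∏ j ∈ (J i).erase t, (1 - u * min 1 (x i * w i j))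
  have hy' : ∀ j, 0 ≤ Function.update y t y₀ j := fun j => by
    by_cases hj : j = t
    · subst hj; simpa using hy₀
    · simpa [hj] using hy j
  have hin : ∀ i, ∏ j ∈ (J i).erase t, (1 - u * edgeProb a b (fun t => (t : ℝ)) (x i)
      (Function.update y t y₀ j) i j) = ∏ j ∈ (J i).erase t, (1 - u * min 1 (x i * w i j)) := by
    intro i
    refine Finset.prod_congr rfl fun j hj => ?_
    rw [Finset.mem_erase] at hj
    rw [edgeProb_of_mem_window ((mem_window_inv ha hb).1 hj.2), Function.update_of_ne hj.1]
  have hΨ : weightPGF a b u t x (Function.update y t y₀) = ∏ i ∈ I, (1 - p i * h i) := by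
    refine Finset.prod_congr rfl fun i hi => ?_
    rw [hin, edgeProb_of_mem_window hi, Function.update_self]
    simp only [p, r, h, mul_one_div]
  have hh : ∀ i, 0 ≤ h i ∧ h i ≤ 1 := fun i => by
    have := weightPGF_inner_mem (a := a) (b := b) hu hu1 hx hy' i ((J i).erase t)
    rwa [hin] at this
  have hp0 : ∀ i, 0 ≤ p i := fun i => le_min zero_le_one
    (mul_nonneg (hx i) (mul_nonneg hy₀ (hr i)))
  have hp1 : ∀ i, p i ≤ 1 := fun i => min_le_left _ _
  have hhg : ∀ i ∈ I, |h i - g i| ≤ x i * ε i := fun i hi => by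
    have := abs_prod_erase_sub_exp_le (J i) (w i) (hw i) ((mem_window_inv ha hb).2 hi)
      (hx i) hu hu1 hc
    rw [show h i - g i = -(∏ j ∈ (J i).erase t, (1 - u * min 1 (x i * w i j)) -
      Real.exp (-(u * (x i * c)))) by simp only [h, g]; ring, abs_neg]
    exact this
  have hg0 : ∀ i, 0 ≤ g i := fun i => sub_nonneg.2 (Real.exp_le_one_iff.2
    (neg_nonpos.2 (mul_nonneg hu (mul_nonneg (hx i) hc))))
  have e1 := abs_prod_one_sub_sub_exp_le I (fun i => p i * h i) fun i _ =>
    ⟨mul_nonneg (hp0 i) (hh i).1, mul_le_one₀ (hp1 i) (hh i).1 (hh i).2⟩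
  have e2 := abs_exp_neg_sub_exp_neg_le (A := ∑ i ∈ I, p i * h i)
    (B := y₀ * ∑ i ∈ I, x i * g i / √((i : ℝ) * t))
    (Finset.sum_nonneg fun i _ => mul_nonneg (hp0 i) (hh i).1)
    (mul_nonneg hy₀ (Finset.sum_nonneg fun i _ =>
      div_nonneg (mul_nonneg (hx i) (hg0 i)) (Real.sqrt_nonneg _)))
  have hsq : ∀ i ∈ I, (x i * (y₀ * r i)) ^ 2 ≤ y₀ ^ 2 * (x i ^ 2 * (√b / i) / √((i : ℝ) * t)) :=
    fun i hi => by
    have h1 := inv_sqrt_le_of_mem_window hb hi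
    calc (x i * (y₀ * r i)) ^ 2 = y₀ ^ 2 * (x i ^ 2 * r i / √((i : ℝ) * t)) := by
          simp only [r]; ring
      _ ≤ _ := by gcongr
  have e3 : ∑ i ∈ I, (p i * h i) ^ 2 ≤
      y₀ ^ 2 * ∑ i ∈ I, x i ^ 2 * (√b / i) / √((i : ℝ) * t) := by
    rw [Finset.mul_sum]
    refine Finset.sum_le_sum fun i hi => ?_
    refine (pow_le_pow_left₀ (mul_nonneg (hp0 i) (hh i).1) ?_ 2).trans (hsq i hi)
    exact (mul_le_of_le_one_right (hp0 i) (hh i).2).trans (min_le_right _ _)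
  have e4 : |∑ i ∈ I, p i * h i - y₀ * ∑ i ∈ I, x i * g i / √((i : ℝ) * t)| ≤
      y₀ ^ 2 * (∑ i ∈ I, x i ^ 2 * (√b / i) / √((i : ℝ) * t)) +
        y₀ * ∑ i ∈ I, x i ^ 2 * ε i / √((i : ℝ) * t) := by
    rw [Finset.mul_sum, Finset.mul_sum, Finset.mul_sum, ← Finset.sum_sub_distrib,
      ← Finset.sum_add_distrib]
    refine (Finset.abs_sum_le_sum_abs _ _).trans (Finset.sum_le_sum fun i hi => ?_)
    have hxr : 0 ≤ x i * (y₀ * r i) := mul_nonneg (hx i) (mul_nonneg hy₀ (hr i))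
    -- First remove the truncation in `p`, then replace `h` by `g`.
    calc |p i * h i - y₀ * (x i * g i / √((i : ℝ) * t))|
        = |(p i - x i * (y₀ * r i)) * h i + x i * (y₀ * r i) * (h i - g i)| := by
          congr 1; simp only [r]; ring
      _ ≤ |p i - x i * (y₀ * r i)| * |h i| + x i * (y₀ * r i) * |h i - g i| := by
          rw [← abs_of_nonneg hxr, ← abs_mul, ← abs_mul, abs_of_nonneg hxr]; exact abs_add_le _ _
      _ ≤ (x i * (y₀ * r i)) ^ 2 * 1 + x i * (y₀ * r i) * (x i * ε i) := by
          gcongr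
          · exact sub_min_one_le_sq
          · rw [abs_of_nonneg (hh i).1]; exact (hh i).2
          · exact hhg i hi
      _ ≤ y₀ ^ 2 * (x i ^ 2 * (√b / i) / √((i : ℝ) * t)) * 1 + x i * (y₀ * r i) * (x i * ε i) := by
          gcongr; exact hsq i hi
      _ = _ := by simp only [r]; ring
  rw [hΨ]
  refine (abs_sub_le _ _ _).trans ((add_le_add (e1.trans e3) (e2.trans e4)).trans (le_of_eq ?_))
  ring

/-- A bound for the conditional expectation, given the weights `x` and `y`, of the number of pairs
of items shared by `v_t` and another actor. -/
noncomputable def sharedPairs (a b : ℝ) (t : ℕ+) (x y : ℕ+ → ℝ) : ℝ :=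
  ∑ j ∈ (window (a / b) (b / a) t).erase t, ∑ i ∈ window a b t, ∑ i' ∈ (window a b t).erase i,
    edgeProb a b (fun t => (t : ℝ)) (x i) (y t) i t *
    edgeProb a b (fun t => (t : ℝ)) (x i') (y t) i' t *
    (edgeProb a b (fun t => (t : ℝ)) (x i) (y j) i j *
    edgeProb a b (fun t => (t : ℝ)) (x i') (y j) i' j)

theorem sharedPairs_nonneg {a b : ℝ} {x y : ℕ+ → ℝ}
    (hx : ∀ i, 0 ≤ x i) (hy : ∀ j, 0 ≤ y j) (t : ℕ+) : 0 ≤ sharedPairs a b t x y :=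
  Finset.sum_nonneg fun _ _ => Finset.sum_nonneg fun _ _ => Finset.sum_nonneg fun _ _ =>
    mul_nonneg (mul_nonneg (edgeProb_nonneg (hx _) (hy _) _ _) (edgeProb_nonneg (hx _) (hy _) _ _))
      (mul_nonneg (edgeProb_nonneg (hx _) (hy _) _ _) (edgeProb_nonneg (hx _) (hy _) _ _))

/-- Dropping the restriction i' ≠ i turns the double sum over items into the square of ∑_i p_it
p_ij. That sum is at most a convergent factor times y_j / √(j t), and the squares of these ratios
sum to o(1). -/
theorem tendsto_sharedPairs_update {a b : ℝ} (ha : 0 < a) (hab : a ≤ b)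
    {x y : ℕ+ → ℝ} (hx : ∀ i, 0 ≤ x i) (hy : ∀ j, 0 ≤ y j) {m₂ b₁ : ℝ}
    (hx2 : CesaroTendsto (fun i => x i ^ 2) m₂) (hyc : CesaroTendsto y b₁)
    {y₀ : ℝ} (hy₀ : 0 ≤ y₀) :
    Tendsto (fun t => sharedPairs a b t x (Function.update y t y₀)) atTop (𝓝 0) := by
  have hb := ha.trans_le hab
  have hA := hx2.tendsto_sum_window ha hab
  have hB := hyc.tendsto_sum_window_sq hy (div_pos ha hb) (β := b / a) (by
    rw [div_le_div_iff₀ hb ha]; nlinarith)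
  have hlim := ((hA.pow 2).mul hB).const_mul (y₀ ^ 2 * a⁻¹)
  rw [mul_zero, mul_zero] at hlim
  have hy' : ∀ t j, 0 ≤ Function.update y t y₀ j := fun t j => by
    by_cases hj : j = t
    · subst hj; simpa using hy₀
    · simpa [hj] using hy j
  refine squeeze_zero (fun t => sharedPairs_nonneg hx (hy' t) t) (fun t => ?_) hlim
  have ht : (0 : ℝ) < t := by exact_mod_cast t.pos
  set I := window a b t
  set J := window (a / b) (b / a) t
  set p : ℕ+ → ℕ+ → ℝ :=
    fun i j => edgeProb a b (fun t => (t : ℝ)) (x i) (Function.update y t y₀ j) i j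
  have hp : ∀ i j, 0 ≤ p i j := fun i j => edgeProb_nonneg (hx i) (hy' t j) i j
  set A := ∑ i ∈ I, x i ^ 2 / √((i : ℝ) * t)
  have hstep : ∀ j ∈ J.erase t, ∑ i ∈ I, p i t * p i j ≤
      y₀ * (√a)⁻¹ * A * (y j / √((j : ℝ) * t)) := by
    intro j hj
    simp only [A]
    rw [Finset.mul_sum, Finset.sum_mul]
    refine Finset.sum_le_sum fun i hi => ?_
    have h1 : p i t ≤ x i * (y₀ / √((i : ℝ) * t)) := by
      simpa [p] using edgeProb_le (a := a) (b := b) (τ := fun t => (t : ℝ)) (hx i) hy₀ i t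
    have h2 : p i j ≤ x i * (y j / √((i : ℝ) * j)) := by
      have := edgeProb_le (a := a) (b := b) (τ := fun t => (t : ℝ)) (hx i) (hy j) i j
      simpa [p, Function.update_of_ne (Finset.ne_of_mem_erase hj)] using this
    have hi0 : (0 : ℝ) < i := by exact_mod_cast i.pos
    have hj0 : (0 : ℝ) < j := by exact_mod_cast j.pos
    -- Since i ≥ a t, the factor 1/√i left over from the edge to v_j can be traded for 1/√(a t).
    have hsi : 1 / √(i : ℝ) ≤ (√a)⁻¹ * (1 / √(t : ℝ)) := by
      rw [← one_div, one_div_mul_one_div, ← Real.sqrt_mul ha.le]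
      exact one_div_le_one_div_of_le (Real.sqrt_pos.2 (by positivity))
        (Real.sqrt_le_sqrt (mem_window.1 hi).1)
    have hxi := hx i
    have hyj := hy j
    calc p i t * p i j ≤ (x i * (y₀ / √((i : ℝ) * t))) * (x i * (y j / √((i : ℝ) * j))) :=
          mul_le_mul h1 h2 (hp i j) (by positivity)
      _ = y₀ * (x i ^ 2 / √((i : ℝ) * t)) * (y j * (1 / √(j : ℝ))) * (1 / √(i : ℝ)) := by
          rw [Real.sqrt_mul hi0.le (j : ℝ)]; ring
      _ ≤ y₀ * (x i ^ 2 / √((i : ℝ) * t)) * (y j * (1 / √(j : ℝ))) *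
          ((√a)⁻¹ * (1 / √(t : ℝ))) := by gcongr
      _ = _ := by rw [Real.sqrt_mul hj0.le (t : ℝ)]; ring
  calc sharedPairs a b t x (Function.update y t y₀)
      ≤ ∑ j ∈ J.erase t, (∑ i ∈ I, p i t * p i j) ^ 2 := by
        unfold sharedPairs
        refine Finset.sum_le_sum fun j _ => ?_
        rw [sq, Finset.sum_mul_sum]
        refine Finset.sum_le_sum fun i _ => ?_
        calc _ ≤ ∑ i' ∈ I, p i t * p i' t * (p i j * p i' j) :=
              Finset.sum_le_sum_of_subset_of_nonneg (Finset.erase_subset _ _) fun i' _ _ =>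
                mul_nonneg (mul_nonneg (hp _ _) (hp _ _)) (mul_nonneg (hp _ _) (hp _ _))
          _ = _ := Finset.sum_congr rfl fun i' _ => by ring
    _ ≤ ∑ j ∈ J.erase t, (y₀ * (√a)⁻¹ * A * (y j / √((j : ℝ) * t))) ^ 2 := by
        refine Finset.sum_le_sum fun j hj => pow_le_pow_left₀ ?_ (hstep j hj) 2
        exact Finset.sum_nonneg fun i _ => mul_nonneg (hp _ _) (hp _ _)
    _ ≤ ∑ j ∈ J, (y₀ * (√a)⁻¹ * A * (y j / √((j : ℝ) * t))) ^ 2 :=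
        Finset.sum_le_sum_of_subset_of_nonneg (Finset.erase_subset _ _) fun _ _ _ => sq_nonneg _
    _ = y₀ ^ 2 * a⁻¹ * (A ^ 2 * ∑ j ∈ J, (y j / √((j : ℝ) * t)) ^ 2) := by
        simp only [mul_pow, inv_pow, Real.sq_sqrt ha.le, Finset.mul_sum]
        exact Finset.sum_congr rfl fun j _ => by ring

/-! ### Random weights: law of large numbers and resampling of one weight -/

theorem ae_cesaroTendsto_comp {Ω : Type*} [MeasurableSpace Ω] {P : Measure Ω}
    {Z : ℕ+ → Ω → ℝ} (hind : iIndepFun Z P) (hid : ∀ i, IdentDistrib (Z i) (Z 1) P P)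
    {φ : ℝ → ℝ} (hφ : Measurable φ) (hint : Integrable (fun ω => φ (Z 1 ω)) P) :
    ∀ᵐ ω ∂P, CesaroTendsto (fun i => φ (Z i ω)) (∫ ω, φ (Z 1 ω) ∂P) := by
  refine strong_law_ae_real (fun n ω => φ (Z n.succPNat ω)) hint ?_ ?_
  · intro i j hij
    exact (hind.indepFun (fun h => hij (Nat.succPNat_injective h))).comp hφ hφ
  · intro i
    exact (hid i.succPNat).comp hφ

/-- It suffices to test finite boxes: there the fresh variable supplies the factor of coordinate
`t`, and the old coordinate `t` is ignored. -/
theorem measurePreserving_update_infinitePi {ι E : Type*} [DecidableEq ι] [MeasurableSpace E]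
    (μ : Measure E) [IsProbabilityMeasure μ] (t : ι) :
    MeasurePreserving (fun q : (ι → E) × E => Function.update q.1 t q.2)
      ((Measure.infinitePi fun _ : ι => μ).prod μ) (Measure.infinitePi fun _ : ι => μ) := by
  have hm : Measurable (fun q : (ι → E) × E => Function.update q.1 t q.2) := by
    refine measurable_pi_iff.2 fun i => ?_
    by_cases hi : i = t
    · subst hi; simpa using measurable_snd
    · simpa only [Function.update_of_ne hi, Function.comp_def] using (measurable_pi_apply i).comp measurable_fst
  refine ⟨hm, Measure.eq_infinitePi _ fun s B hB => ?_⟩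
  rw [Measure.map_apply hm (.pi s.countable_toSet fun i _ => hB i)]
  by_cases hts : t ∈ s
  · have : (fun q : (ι → E) × E => Function.update q.1 t q.2) ⁻¹' (Set.pi s B) =
        (Set.pi ((s.erase t : Finset ι) : Set ι) B) ×ˢ (B t) := by
      ext q
      simp only [Set.mem_preimage, Set.mem_pi, Finset.mem_coe, Set.mem_prod, Finset.mem_erase]
      constructor
      · intro h
        exact ⟨fun i hi => by simpa [hi.1] using h i hi.2, by simpa using h t hts⟩
      · rintro ⟨h1, h2⟩ i hi
        by_cases hit : i = t
        · subst hit; simpa using h2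
        · simpa [hit] using h1 i ⟨hit, hi⟩
    rw [this, Measure.prod_prod, Measure.infinitePi_pi _ fun i _ => hB i,
      Finset.prod_erase_mul _ _ hts]
  · have : (fun q : (ι → E) × E => Function.update q.1 t q.2) ⁻¹' (Set.pi s B) =
        (Set.pi (s : Set ι) B) ×ˢ Set.univ := by
      ext q
      simp only [Set.mem_preimage, Set.mem_pi, Finset.mem_coe, Set.mem_prod, Set.mem_univ, and_true]
      refine forall₂_congr fun i hi => ?_
      rw [Function.update_of_ne (fun h : i = t => hts (h ▸ hi))]
    rw [this, Measure.prod_prod, Measure.infinitePi_pi _ fun i _ => hB i, measure_univ, mul_one]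

theorem IsRandomBipartiteGraph.ae_nonneg {Ω : Type*} [MeasurableSpace Ω] {P : Measure Ω}
    {a b : ℝ} {τ : ℕ+ → ℝ} {X Y : ℕ+ → Ω → ℝ} {H : Ω → ℕ+ → ℕ+ → Prop}
    (hH : IsRandomBipartiteGraph P a b τ X Y H) :
    ∀ᵐ ω ∂P, (∀ i, 0 ≤ X i ω) ∧ ∀ j, 0 ≤ Y j ω :=
  (ae_all_iff.2 hH.nonneg_X).and (ae_all_iff.2 hH.nonneg_Y)

section Weights

variable {Ω : Type*} [MeasurableSpace Ω] {P : Measure Ω} [IsProbabilityMeasure P]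
  {a b : ℝ} {τ : ℕ+ → ℝ} {X Y : ℕ+ → Ω → ℝ} {H : Ω → ℕ+ → ℕ+ → Prop}

/-- The actor weights are independent of the item weights and their law is a product measure, so
resampling coordinate `t` preserves the joint law. -/
theorem IsRandomBipartiteGraph.map_update_eq (hH : IsRandomBipartiteGraph P a b τ X Y H) (t : ℕ+) :
    (P.prod (P.map (Y 1))).map
        (fun q => ((fun i => X i q.1), Function.update (fun j => Y j q.1) t q.2)) =
      P.map (fun ω => ((fun i => X i ω), fun j => Y j ω)) := by
  have hXm : Measurable (fun ω i => X i ω) := measurable_pi_iff.2 hH.measurable_X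
  have hYm : Measurable (fun ω j => Y j ω) := measurable_pi_iff.2 hH.measurable_Y
  have : IsProbabilityMeasure (P.map (Y 1)) :=
    Measure.isProbabilityMeasure_map (hH.measurable_Y 1).aemeasurable
  have : IsProbabilityMeasure (P.map (fun ω i => X i ω)) :=
    Measure.isProbabilityMeasure_map hXm.aemeasurable
  have hYlaw : P.map (fun ω j => Y j ω) = Measure.infinitePi fun _ : ℕ+ => P.map (Y 1) := by
    rw [hH.iIndep_Y.map_fun_eq_infinitePi_map hH.measurable_Y]
    congr with i : 1
    exact (hH.identDistrib_Y i).map_eq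
  have hjoint : P.map (fun ω => ((fun i => X i ω), fun j => Y j ω)) =
      (P.map (fun ω i => X i ω)).prod (Measure.infinitePi fun _ : ℕ+ => P.map (Y 1)) := by
    rw [← hYlaw]
    exact (indepFun_iff_map_prod_eq_prod_map_map hXm.aemeasurable hYm.aemeasurable).1 hH.indep_X_Y
  have h1 : MeasurePreserving (fun ω => ((fun i => X i ω), fun j => Y j ω)) P
      ((P.map (fun ω i => X i ω)).prod (Measure.infinitePi fun _ : ℕ+ => P.map (Y 1))) :=
    ⟨hXm.prodMk hYm, hjoint⟩
  have h2 := h1.prod (MeasurePreserving.id (P.map (Y 1)))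
  have h3 := (measurePreserving_prodAssoc (P.map (fun ω i => X i ω))
    (Measure.infinitePi fun _ : ℕ+ => P.map (Y 1)) (P.map (Y 1))).comp h2
  have h4 := ((MeasurePreserving.id (P.map (fun ω i => X i ω))).prod
    (measurePreserving_update_infinitePi (P.map (Y 1)) t)).comp h3
  rw [hjoint]
  exact h4.map_eq

/-- The weight of the distinguished actor may be replaced by an independent copy; this turns almost
sure convergence for fixed weights into convergence of expectations. -/
theorem IsRandomBipartiteGraph.tendsto_integral_of_update
    (hH : IsRandomBipartiteGraph P a b τ X Y H) {F : ℕ+ → (ℕ+ → ℝ) → (ℕ+ → ℝ) → ℝ}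
    (hF : ∀ t, Measurable (Function.uncurry (F t)))
    (hF1 : ∀ t x y, (∀ i, 0 ≤ x i) → (∀ j, 0 ≤ y j) → |F t x y| ≤ 1)
    {G : ℝ → ℝ} (hG : Measurable G)
    (hlim : ∀ᵐ ω ∂P, ∀ y₀, 0 ≤ y₀ → Tendsto
      (fun t => F t (fun i => X i ω) (Function.update (fun j => Y j ω) t y₀)) atTop (𝓝 (G y₀))) :
    Tendsto (fun t => ∫ ω, F t (fun i => X i ω) (fun j => Y j ω) ∂P) atTop
      (𝓝 (∫ ω, G (Y 1 ω) ∂P)) := by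
  have hXm : Measurable (fun ω i => X i ω) := measurable_pi_iff.2 hH.measurable_X
  have hYm : Measurable (fun ω j => Y j ω) := measurable_pi_iff.2 hH.measurable_Y
  have : IsProbabilityMeasure (P.map (Y 1)) :=
    Measure.isProbabilityMeasure_map (hH.measurable_Y 1).aemeasurable
  have hum (t : ℕ+) : Measurable (fun q : Ω × ℝ =>
      ((fun i => X i q.1), Function.update (fun j => Y j q.1) t q.2)) := by
    refine (hXm.comp measurable_fst).prodMk (measurable_pi_iff.2 fun i => ?_)
    by_cases hi : i = t
    · subst hi; simpa using measurable_snd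
    · simpa only [Function.update_of_ne hi, Function.comp_def] using (hH.measurable_Y i).comp measurable_fst
  -- The left side involves Y_t, which varies with t. On the right its place is taken by a variable
  -- independent of everything and the same for all t.
  have hL (t : ℕ+) : ∫ ω, F t (fun i => X i ω) (fun j => Y j ω) ∂P =
      ∫ q, F t (fun i => X i q.1) (Function.update (fun j => Y j q.1) t q.2)
        ∂(P.prod (P.map (Y 1))) := by
    have e1 := integral_map (μ := P) (hXm.prodMk hYm).aemeasurable
      (f := Function.uncurry (F t)) (hF t).aestronglyMeasurable
    have e2 := integral_map (μ := P.prod (P.map (Y 1))) (hum t).aemeasurable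
      (f := Function.uncurry (F t)) (hF t).aestronglyMeasurable
    rw [hH.map_update_eq t] at e2
    exact e1.symm.trans e2
  have hR : ∫ ω, G (Y 1 ω) ∂P = ∫ q, G q.2 ∂(P.prod (P.map (Y 1))) := by
    rw [← integral_map (hH.measurable_Y 1).aemeasurable hG.aestronglyMeasurable]
    have := integral_map (μ := P.prod (P.map (Y 1))) measurable_snd.aemeasurable
      (f := G) hG.aestronglyMeasurable
    rw [← this, Measure.map_snd_prod, measure_univ, one_smul]
  have hnn : ∀ᵐ q ∂(P.prod (P.map (Y 1))), 0 ≤ q.2 := by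
    have h : ∀ᵐ y ∂(P.map (Y 1)), 0 ≤ y := by
      rw [ae_map_iff (hH.measurable_Y 1).aemeasurable measurableSet_Ici]
      exact hH.nonneg_Y 1
    exact Measure.quasiMeasurePreserving_snd.ae h
  have hfst {p : Ω → Prop} (hp : ∀ᵐ ω ∂P, p ω) : ∀ᵐ q ∂(P.prod (P.map (Y 1))), p q.1 :=
    Measure.quasiMeasurePreserving_fst.ae hp
  rw [hR]
  simp only [hL]
  refine tendsto_integral_filter_of_dominated_convergence (fun _ => 1) ?_ ?_
    (integrable_const 1) ?_
  · exact Eventually.of_forall fun t => ((hF t).comp (hum t)).aestronglyMeasurable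
  · refine Eventually.of_forall fun t => ?_
    filter_upwards [hnn, hfst hH.ae_nonneg] with q h1 h2
    refine hF1 t _ _ h2.1 fun j => ?_
    by_cases hj : j = t
    · subst hj; simpa using h1
    · simpa [hj] using h2.2 j
  · filter_upwards [hnn, hfst hlim] with q h1 h2 using h2 q.2 h1

end Weights

theorem measurable_edgeProb (a b : ℝ) (τ : ℕ+ → ℝ) (i j k l : ℕ+) :
    Measurable (fun q : (ℕ+ → ℝ) × (ℕ+ → ℝ) => edgeProb a b τ (q.1 k) (q.2 l) i j) := by
  unfold edgeProb
  split_ifs <;> fun_prop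

theorem measurable_weightPGF (a b u : ℝ) (t : ℕ+) :
    Measurable (Function.uncurry (weightPGF a b u t)) := by
  unfold weightPGF Function.uncurry
  have h := measurable_edgeProb a b (fun t => (t : ℝ))
  refine Finset.measurable_fun_prod _ fun i _ => measurable_const.sub ((h i t i t).mul
    (measurable_const.sub (Finset.measurable_fun_prod _ fun j _ =>
      measurable_const.sub ((h i j i j).const_mul u))))

theorem measurable_sharedPairs (a b : ℝ) (t : ℕ+) :
    Measurable (Function.uncurry (sharedPairs a b t)) := by
  unfold sharedPairs Function.uncurry
  have h := measurable_edgeProb a b (fun t => (t : ℝ))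
  exact Finset.measurable_fun_sum _ fun j _ => Finset.measurable_fun_sum _ fun i _ =>
    Finset.measurable_fun_sum _ fun i' _ =>
      ((h _ _ _ _).mul (h _ _ _ _)).mul ((h _ _ _ _).mul (h _ _ _ _))

section Limits

variable {Ω : Type*} [MeasurableSpace Ω] {P : Measure Ω} [IsProbabilityMeasure P]
  {a b : ℝ} {X Y : ℕ+ → Ω → ℝ} {H : Ω → ℕ+ → ℕ+ → Prop}

theorem IsRandomBipartiteGraph.integrable_X
    (hH : IsRandomBipartiteGraph P a b (fun t => (t : ℝ)) X Y H)
    (hX : Integrable (fun ω => X 1 ω ^ 2) P) : Integrable (X 1) P :=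
  ((memLp_two_iff_integrable_sq (hH.measurable_X 1).aestronglyMeasurable).2 hX).integrable
    one_le_two

theorem IsRandomBipartiteGraph.tendsto_integral_weightPGF (ha : 0 < a) (hab : a ≤ b)
    (hH : IsRandomBipartiteGraph P a b (fun t => (t : ℝ)) X Y H)
    (hX : Integrable (fun ω => X 1 ω ^ 2) P) (hY : Integrable (Y 1) P)
    {u : ℝ} (hu : 0 ≤ u) (hu1 : u ≤ 1) :
    Tendsto (fun t => ∫ ω, weightPGF a b u t (fun i => X i ω) (fun j => Y j ω) ∂P) atTop
      (𝓝 (∫ ω, Real.exp (-(Y 1 ω * (2 * (√b - √a) * ∫ ω', X 1 ω' * (1 - Real.exp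
        (-(u * (X 1 ω' * (2 * (√a⁻¹ - √b⁻¹) * ∫ ω'', Y 1 ω'' ∂P))))) ∂P))) ∂P)) := by
  set b₁ := ∫ ω, Y 1 ω ∂P
  set c := 2 * (√a⁻¹ - √b⁻¹) * b₁
  have hb₁ : 0 ≤ b₁ := integral_nonneg_of_ae (hH.nonneg_Y 1)
  have hc : 0 ≤ c := by
    have := Real.sqrt_le_sqrt (inv_anti₀ ha hab)
    exact mul_nonneg (by linarith) hb₁
  have hint : Integrable (fun ω => X 1 ω * (1 - Real.exp (-(u * (X 1 ω * c))))) P := by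
    refine (hH.integrable_X hX).mono
      (((hH.measurable_X 1).mul (by have := hH.measurable_X 1; fun_prop)).aestronglyMeasurable) ?_
    filter_upwards [hH.nonneg_X 1] with ω hω
    rw [norm_mul]
    refine mul_le_of_le_one_right (norm_nonneg _) ?_
    have h1 : Real.exp (-(u * (X 1 ω * c))) ≤ 1 :=
      Real.exp_le_one_iff.2 (neg_nonpos.2 (by positivity))
    have h2 := Real.exp_pos (-(u * (X 1 ω * c)))
    exact abs_le.2 ⟨by linarith, by linarith⟩
  refine hH.tendsto_integral_of_update (measurable_weightPGF a b u)
    (fun t x y hx hy => ?_) (G := fun y => Real.exp (-(y * (2 * (√b - √a) *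
      ∫ ω', X 1 ω' * (1 - Real.exp (-(u * (X 1 ω' * c)))) ∂P)))) (by fun_prop) ?_
  · have := weightPGF_mem (a := a) (b := b) hu hu1 hx hy t
    exact abs_le.2 ⟨by linarith, this.2⟩
  · filter_upwards [hH.ae_nonneg,
      ae_cesaroTendsto_comp hH.iIndep_X hH.identDistrib_X (φ := fun x => x ^ 2) (by fun_prop) hX,
      ae_cesaroTendsto_comp hH.iIndep_Y hH.identDistrib_Y (φ := fun x => x) (by fun_prop) hY,
      ae_cesaroTendsto_comp hH.iIndep_X hH.identDistrib_X
        (φ := fun x => x * (1 - Real.exp (-(u * (x * c))))) (by fun_prop) hint]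
      with ω h1 h2 h3 h4 y₀ hy₀
    exact tendsto_weightPGF_update ha hab hu hu1 h1.1 h1.2 hb₁ h2 h3 h4 hy₀

/-- The truncation at 1 provides the dominating function: the bound for fixed weights carries the
square of the weight of v_t, and only its first moment is assumed. -/
theorem IsRandomBipartiteGraph.tendsto_integral_sharedPairs (ha : 0 < a) (hab : a ≤ b)
    (hH : IsRandomBipartiteGraph P a b (fun t => (t : ℝ)) X Y H)
    (hX : Integrable (fun ω => X 1 ω ^ 2) P) (hY : Integrable (Y 1) P) :
    Tendsto (fun t => ∫ ω, min 1 (sharedPairs a b t (fun i => X i ω) (fun j => Y j ω)) ∂P) atTop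
      (𝓝 0) := by
  have := hH.tendsto_integral_of_update (F := fun t x y => min 1 (sharedPairs a b t x y))
    (fun t => measurable_const.min (measurable_sharedPairs a b t))
    (fun t x y hx hy => by
      rw [abs_of_nonneg (le_min zero_le_one (sharedPairs_nonneg hx hy t))]
      exact min_le_left _ _)
    (G := fun _ => 0) measurable_const ?_
  · simpa using this
  · filter_upwards [hH.ae_nonneg,
      ae_cesaroTendsto_comp hH.iIndep_X hH.identDistrib_X (φ := fun x => x ^ 2) (by fun_prop) hX,
      ae_cesaroTendsto_comp hH.iIndep_Y hH.identDistrib_Y (φ := fun x => x) (by fun_prop) hY]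
      with ω h1 h2 h3 y₀ hy₀
    have h := tendsto_sharedPairs_update ha hab h1.1 h1.2 h2 h3 hy₀
    simpa using (tendsto_const_nhds (x := (1 : ℝ))).min h

end Limits

/-! ### Conditional means of functions of the edges -/

/-- The indicator of the edge `{w_i, v_j}`, where `e = (i, j)`. -/
noncomputable def edgeIndicator {Ω : Type*} (H : Ω → ℕ+ → ℕ+ → Prop) (e : ℕ+ × ℕ+) (ω : Ω) : ℝ :=
  open Classical in if H ω e.1 e.2 then 1 else 0

theorem edgeIndicator_of_edge {Ω : Type*} {H : Ω → ℕ+ → ℕ+ → Prop} {i j : ℕ+} {ω : Ω}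
    (h : H ω i j) : edgeIndicator H (i, j) ω = 1 := if_pos h

theorem edgeIndicator_of_not_edge {Ω : Type*} {H : Ω → ℕ+ → ℕ+ → Prop} {i j : ℕ+} {ω : Ω}
    (h : ¬ H ω i j) : edgeIndicator H (i, j) ω = 0 := if_neg h

theorem edgeIndicator_nonneg {Ω : Type*} (H : Ω → ℕ+ → ℕ+ → Prop) (e : ℕ+ × ℕ+) (ω : Ω) :
    0 ≤ edgeIndicator H e ω := by
  unfold edgeIndicator; split_ifs <;> norm_num

theorem edgeIndicator_le_one {Ω : Type*} (H : Ω → ℕ+ → ℕ+ → Prop) (e : ℕ+ × ℕ+) (ω : Ω) :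
    edgeIndicator H e ω ≤ 1 := by
  unfold edgeIndicator; split_ifs <;> norm_num

/-- `G` is a bounded function of the edges in `E` whose conditional mean given the weights is `g`,
also after multiplication by indicators of other edges. -/
structure HasCondMean {Ω : Type*} [MeasurableSpace Ω] (P : Measure Ω)
    (a b : ℝ) (τ : ℕ+ → ℝ) (X Y : ℕ+ → Ω → ℝ) (H : Ω → ℕ+ → ℕ+ → Prop)
    (E : Set (ℕ+ × ℕ+)) (G g : Ω → ℝ) : Prop where
  measurable : Measurable G
  bounded : ∃ C, ∀ ω, |G ω| ≤ C
  condExp_eq : ∀ S : Finset (ℕ+ × ℕ+), (∀ e ∈ S, e ∉ E) →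
    P[fun ω => G ω * ∏ e ∈ S, edgeIndicator H e ω | weightSigma X Y] =ᵐ[P]
      fun ω => g ω * ∏ e ∈ S, edgeProb a b τ (X e.1 ω) (Y e.2 ω) e.1 e.2

section

variable {Ω : Type*} [MeasurableSpace Ω] {P : Measure Ω}
  {a b : ℝ} {τ : ℕ+ → ℝ} {X Y : ℕ+ → Ω → ℝ} {H : Ω → ℕ+ → ℕ+ → Prop}

theorem IsRandomBipartiteGraph.measurable_edgeIndicator (hH : IsRandomBipartiteGraph P a b τ X Y H)
    (e : ℕ+ × ℕ+) : Measurable (edgeIndicator H e) :=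
  Measurable.ite (hH.measurableSet_edge e.1 e.2) measurable_const measurable_const

theorem IsRandomBipartiteGraph.weightSigma_le (hH : IsRandomBipartiteGraph P a b τ X Y H) :
    weightSigma X Y ≤ ‹MeasurableSpace Ω› :=
  sup_le (iSup_le fun i => (hH.measurable_X i).comap_le)
    (iSup_le fun j => (hH.measurable_Y j).comap_le)

/-- The base of all later constructions, and the point where the conditional edge probabilities of
the model enter. -/
theorem IsRandomBipartiteGraph.hasCondMean_one (hH : IsRandomBipartiteGraph P a b τ X Y H) :
    HasCondMean P a b τ X Y H ∅ (fun _ => 1) (fun _ => 1) where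
  measurable := measurable_const
  bounded := ⟨1, by simp⟩
  condExp_eq S _ := by
    have : (fun ω => 1 * ∏ e ∈ S, edgeIndicator H e ω) =
        Set.indicator {ω | ∀ e ∈ S, H ω e.1 e.2} (fun _ => (1 : ℝ)) := by
      classical
      ext ω
      by_cases h : ∀ e ∈ S, H ω e.1 e.2
      · rw [Set.indicator_of_mem (by exact h), one_mul]
        exact Finset.prod_eq_one fun e he => if_pos (h e he)
      · rw [Set.indicator_of_notMem (by exact h), one_mul]
        push Not at h
        obtain ⟨e, he, hne⟩ := h
        exact Finset.prod_eq_zero he (if_neg hne)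
    rw [this]
    simpa using hH.condProb_edges S

theorem HasCondMean.mono {E E' : Set (ℕ+ × ℕ+)} {G g : Ω → ℝ}
    (h : HasCondMean P a b τ X Y H E G g) (hE : E ⊆ E') :
    HasCondMean P a b τ X Y H E' G g where
  measurable := h.measurable
  bounded := h.bounded
  condExp_eq S hS := h.condExp_eq S fun e he h' => hS e he (hE h')

/-- This is why the definition quantifies over finite sets of further edges: apply it to `S` with
`e` added. Conditional independence is thus used without regular conditional laws. -/
theorem HasCondMean.mul_edge {E : Set (ℕ+ × ℕ+)} {G g : Ω → ℝ}
    (h : HasCondMean P a b τ X Y H E G g) (hH : IsRandomBipartiteGraph P a b τ X Y H)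
    {e : ℕ+ × ℕ+} (he : e ∉ E) :
    HasCondMean P a b τ X Y H (insert e E) (fun ω => G ω * edgeIndicator H e ω)
      (fun ω => g ω * edgeProb a b τ (X e.1 ω) (Y e.2 ω) e.1 e.2) where
  measurable := h.measurable.mul (hH.measurable_edgeIndicator e)
  bounded := by
    obtain ⟨C, hC⟩ := h.bounded
    refine ⟨C, fun ω => ?_⟩
    rw [abs_mul, abs_of_nonneg (edgeIndicator_nonneg H e ω)]
    exact (mul_le_of_le_one_right (abs_nonneg _) (edgeIndicator_le_one H e ω)).trans (hC ω)
  condExp_eq S hS := by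
    have heS : e ∉ S := fun h' => hS e h' (Set.mem_insert _ _)
    have := h.condExp_eq (insert e S) (by
      intro f hf
      rcases Finset.mem_insert.1 hf with rfl | hf
      · exact he
      · exact fun h' => hS f hf (Set.mem_insert_of_mem _ h'))
    simpa only [Finset.prod_insert heS, mul_assoc] using this

theorem HasCondMean.integrable_mul [IsFiniteMeasure P] {E : Set (ℕ+ × ℕ+)} {G g : Ω → ℝ}
    (h : HasCondMean P a b τ X Y H E G g) (hH : IsRandomBipartiteGraph P a b τ X Y H)
    (S : Finset (ℕ+ × ℕ+)) : Integrable (fun ω => G ω * ∏ e ∈ S, edgeIndicator H e ω) P := by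
  obtain ⟨C, hC⟩ := h.bounded
  refine Integrable.of_bound ((h.measurable.mul (Finset.measurable_fun_prod _ fun e _ =>
    hH.measurable_edgeIndicator e)).aestronglyMeasurable) C (Eventually.of_forall fun ω => ?_)
  have h0 : 0 ≤ ∏ e ∈ S, edgeIndicator H e ω := Finset.prod_nonneg fun e _ => edgeIndicator_nonneg ..
  have h1 : ∏ e ∈ S, edgeIndicator H e ω ≤ 1 :=
    Finset.prod_le_one (fun e _ => edgeIndicator_nonneg ..) fun e _ => edgeIndicator_le_one ..
  rw [Real.norm_eq_abs, abs_mul, abs_of_nonneg h0]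
  exact (mul_le_of_le_one_right (abs_nonneg _) h1).trans (hC ω)

theorem HasCondMean.sub_const_mul [IsFiniteMeasure P] {E : Set (ℕ+ × ℕ+)} {G g G' g' : Ω → ℝ}
    (h : HasCondMean P a b τ X Y H E G g) (h' : HasCondMean P a b τ X Y H E G' g')
    (hH : IsRandomBipartiteGraph P a b τ X Y H) (c : ℝ) :
    HasCondMean P a b τ X Y H E (fun ω => G ω - c * G' ω) (fun ω => g ω - c * g' ω) where
  measurable := h.measurable.sub (h'.measurable.const_mul c)
  bounded := by
    obtain ⟨C, hC⟩ := h.bounded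
    obtain ⟨C', hC'⟩ := h'.bounded
    refine ⟨C + |c| * C', fun ω => (abs_sub _ _).trans (add_le_add (hC ω) ?_)⟩
    rw [abs_mul]
    exact mul_le_mul_of_nonneg_left (hC' ω) (abs_nonneg c)
  condExp_eq S hS := by
    have e1 : (fun ω => (G ω - c * G' ω) * ∏ e ∈ S, edgeIndicator H e ω) =
        (fun ω => G ω * ∏ e ∈ S, edgeIndicator H e ω) -
          c • fun ω => G' ω * ∏ e ∈ S, edgeIndicator H e ω := by
      ext ω; simp only [Pi.sub_apply, Pi.smul_apply, smul_eq_mul]; ring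
    rw [e1]
    filter_upwards [condExp_sub (h.integrable_mul hH S) ((h'.integrable_mul hH S).smul c)
      (weightSigma X Y), condExp_smul (μ := P) c
      (fun ω => G' ω * ∏ e ∈ S, edgeIndicator H e ω) (weightSigma X Y),
      h.condExp_eq S hS, h'.condExp_eq S hS] with ω h1 h2 h3 h4
    rw [h1, Pi.sub_apply, h2, Pi.smul_apply, h3, h4, smul_eq_mul]
    ring

theorem HasCondMean.congr {E : Set (ℕ+ × ℕ+)} {G g G' g' : Ω → ℝ}
    (h : HasCondMean P a b τ X Y H E G g) (hG : ∀ ω, G' ω = G ω) (hg : ∀ ω, g' ω = g ω) :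
    HasCondMean P a b τ X Y H E G' g' := by
  rwa [funext hG, funext hg]

theorem HasCondMean.integral_eq [IsFiniteMeasure P] {E : Set (ℕ+ × ℕ+)} {G g : Ω → ℝ}
    (h : HasCondMean P a b τ X Y H E G g) (hH : IsRandomBipartiteGraph P a b τ X Y H) :
    ∫ ω, G ω ∂P = ∫ ω, g ω ∂P := by
  have h1 := h.condExp_eq ∅ (by simp)
  simp only [Finset.prod_empty, mul_one] at h1
  rw [← integral_condExp hH.weightSigma_le, integral_congr_ae h1]

/-- Each new factor is affine in one fresh edge indicator, so linearity and `HasCondMean.mul_edge`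
suffice. -/
theorem HasCondMean.mul_prod_one_sub [IsFiniteMeasure P] {E : Set (ℕ+ × ℕ+)} {G g : Ω → ℝ}
    (h : HasCondMean P a b τ X Y H E G g) (hH : IsRandomBipartiteGraph P a b τ X Y H) (u : ℝ)
    (T : Finset (ℕ+ × ℕ+)) (hT : ∀ e ∈ T, e ∉ E) :
    HasCondMean P a b τ X Y H (E ∪ T) (fun ω => G ω * ∏ e ∈ T, (1 - u * edgeIndicator H e ω))
      (fun ω => g ω * ∏ e ∈ T, (1 - u * edgeProb a b τ (X e.1 ω) (Y e.2 ω) e.1 e.2)) := by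
  classical
  induction T using Finset.induction_on with
  | empty => simpa using h
  | insert e T he ih =>
    have h1 := ih fun f hf => hT f (Finset.mem_insert_of_mem hf)
    have heE : e ∉ E ∪ T := by
      rintro (h' | h')
      · exact hT e (Finset.mem_insert_self _ _) h'
      · exact he h'
    have hset : E ∪ ((insert e T : Finset (ℕ+ × ℕ+)) : Set (ℕ+ × ℕ+)) = insert e (E ∪ T) := by
      rw [Finset.coe_insert, Set.union_insert]
    rw [hset]
    refine ((h1.mono (Set.subset_insert e _)).sub_const_mul (h1.mul_edge hH heE) hH u).congr ?_ ?_
    · intro ω; rw [Finset.prod_insert he]; ring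
    · intro ω; rw [Finset.prod_insert he]; ring

theorem HasCondMean.mul_item [IsFiniteMeasure P] {K : Set ℕ+} {G g : Ω → ℝ}
    (h : HasCondMean P a b τ X Y H (K ×ˢ Set.univ) G g)
    (hH : IsRandomBipartiteGraph P a b τ X Y H) (u : ℝ) {i : ℕ+} (hi : i ∉ K)
    {t : ℕ+} {J : Finset ℕ+} (ht : t ∉ J) :
    HasCondMean P a b τ X Y H (insert i K ×ˢ Set.univ)
      (fun ω => G ω * (1 - edgeIndicator H (i, t) ω *
        (1 - ∏ j ∈ J, (1 - u * edgeIndicator H (i, j) ω))))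
      (fun ω => g ω * (1 - edgeProb a b τ (X i ω) (Y t ω) i t *
        (1 - ∏ j ∈ J, (1 - u * edgeProb a b τ (X i ω) (Y j ω) i j)))) := by
  classical
  have hit : (i, t) ∉ K ×ˢ (Set.univ : Set ℕ+) := fun h' => hi h'.1
  have h1 := h.mul_edge hH hit
  have h2 := h1.mul_prod_one_sub hH u (J.image fun j => (i, j)) (by
    intro e he
    obtain ⟨j, hj, rfl⟩ := Finset.mem_image.1 he
    rintro (h' | h')
    · exact ht ((Prod.mk.inj h').2 ▸ hj)
    · exact hi h'.1)
  have hinj : Set.InjOn (fun j : ℕ+ => (i, j)) J := fun _ _ _ _ h => (Prod.mk.inj h).2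
  simp only [Finset.prod_image hinj] at h2
  have hs1 : insert (i, t) (K ×ˢ (Set.univ : Set ℕ+)) ⊆ insert i K ×ˢ Set.univ := by
    rintro e (rfl | he)
    · exact ⟨Set.mem_insert _ _, trivial⟩
    · exact ⟨Set.mem_insert_of_mem _ he.1, trivial⟩
  have hs0 : K ×ˢ (Set.univ : Set ℕ+) ⊆ insert i K ×ˢ Set.univ :=
    (Set.subset_insert _ _).trans hs1
  have hs2 : insert (i, t) (K ×ˢ (Set.univ : Set ℕ+)) ∪
      (J.image (fun j => (i, j)) : Finset (ℕ+ × ℕ+)) ⊆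
        insert i K ×ˢ Set.univ := by
    rintro e (he | he)
    · exact hs1 he
    · obtain ⟨j, hj, rfl⟩ := Finset.mem_image.1 he
      exact ⟨Set.mem_insert _ _, trivial⟩
  -- With A the edge to v_t and Π the product over j, expand G(1 - A(1 - Π)) = G - GA + GAΠ.
  refine (((h.mono hs0).sub_const_mul (h1.mono hs1) hH 1).sub_const_mul (h2.mono hs2) hH (-1)).congr
    ?_ ?_
  · intro ω; ring
  · intro ω; ring

/-- Different items use disjoint rows of edges, so the factors can be attached one item at a time.
-/
theorem IsRandomBipartiteGraph.hasCondMean_prod_items [IsFiniteMeasure P]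
    (hH : IsRandomBipartiteGraph P a b τ X Y H) (u : ℝ) (t : ℕ+) (I : Finset ℕ+)
    (J : ℕ+ → Finset ℕ+) (hJ : ∀ i, t ∉ J i) :
    HasCondMean P a b τ X Y H ((I : Set ℕ+) ×ˢ Set.univ)
      (fun ω => ∏ i ∈ I, (1 - edgeIndicator H (i, t) ω *
        (1 - ∏ j ∈ J i, (1 - u * edgeIndicator H (i, j) ω))))
      (fun ω => ∏ i ∈ I, (1 - edgeProb a b τ (X i ω) (Y t ω) i t *
        (1 - ∏ j ∈ J i, (1 - u * edgeProb a b τ (X i ω) (Y j ω) i j)))) := by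
  classical
  induction I using Finset.induction_on with
  | empty => simpa using hH.hasCondMean_one
  | insert i I hi ih =>
    rw [Finset.coe_insert]
    refine (ih.mul_item hH u (i := i) (by simpa using hi) (hJ i)).congr ?_ ?_
    · intro ω; rw [Finset.prod_insert hi]; ring
    · intro ω; rw [Finset.prod_insert hi]; ring

theorem IsRandomBipartiteGraph.hasCondMean_pair [IsFiniteMeasure P]
    (hH : IsRandomBipartiteGraph P a b τ X Y H) {i i' j t : ℕ+} (hi : i' ≠ i) (hj : j ≠ t) :
    HasCondMean P a b τ X Y H Set.univ
      (fun ω => edgeIndicator H (i, t) ω * edgeIndicator H (i', t) ω *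
        (edgeIndicator H (i, j) ω * edgeIndicator H (i', j) ω))
      (fun ω => edgeProb a b τ (X i ω) (Y t ω) i t * edgeProb a b τ (X i' ω) (Y t ω) i' t *
        (edgeProb a b τ (X i ω) (Y j ω) i j * edgeProb a b τ (X i' ω) (Y j ω) i' j)) := by
  refine (((((hH.hasCondMean_one.mul_edge hH (e := (i, t)) ?_).mul_edge hH (e := (i', t)) ?_).mul_edge
    hH (e := (i, j)) ?_).mul_edge hH (e := (i', j)) ?_).mono (Set.subset_univ _)).congr ?_ ?_
  · simp
  · simp [hi]
  · simp [hj]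
  · simp [hi, hj]
  · intro ω; ring
  · intro ω; ring

end

/-! ### Degree, path count and 4-cycles -/

/-- The number of pairs of edges `{v_t, w_i}, {w_i, v_j}` with `j ≠ t`. -/
noncomputable def pathCount (a b : ℝ) (h : ℕ+ → ℕ+ → Prop) (t : ℕ+) : ℕ :=
  open Classical in
  ∑ i ∈ (window a b t).filter (fun i => h i t),
    (((window b⁻¹ a⁻¹ i).erase t).filter (fun j => h i j)).card

/-- The number of quadruples of edges forming a cycle through `v_t`, counted with orientation. -/
noncomputable def cycleCount {Ω : Type*} (a b : ℝ) (H : Ω → ℕ+ → ℕ+ → Prop) (t : ℕ+) (ω : Ω) : ℝ :=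
  ∑ j ∈ (window (a / b) (b / a) t).erase t, ∑ i ∈ window a b t, ∑ i' ∈ (window a b t).erase i,
    edgeIndicator H (i, t) ω * edgeIndicator H (i', t) ω *
      (edgeIndicator H (i, j) ω * edgeIndicator H (i', j) ω)

/-- The degree of `v_t`, computed within the finite range of possible neighbours. -/
noncomputable def localDegree (a b : ℝ) (h : ℕ+ → ℕ+ → Prop) (t : ℕ+) : ℕ :=
  open Classical in
  ∑ j ∈ (window (a / b) (b / a) t).erase t, if ∃ i ∈ window a b t, h i t ∧ h i j then 1 else 0

/-- Present edges contribute a factor s = 1 - (1 - s) and absent ones a factor 1. In this form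
conditional expectations replace indicators by probabilities and yield `weightPGF` at u = 1 - s. -/
theorem pow_pathCount {Ω : Type*} (a b : ℝ) (H : Ω → ℕ+ → ℕ+ → Prop) (t : ℕ+) (s : ℝ) (ω : Ω) :
    s ^ pathCount a b (H ω) t = ∏ i ∈ window a b t, (1 - edgeIndicator H (i, t) ω *
      (1 - ∏ j ∈ (window b⁻¹ a⁻¹ i).erase t, (1 - (1 - s) * edgeIndicator H (i, j) ω))) := by
  classical
  unfold pathCount
  rw [← Finset.prod_pow_eq_pow_sum, Finset.prod_filter]
  refine Finset.prod_congr rfl fun i _ => ?_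
  split_ifs with hi
  · rw [edgeIndicator_of_edge hi, Finset.card_eq_sum_ones, ← Finset.prod_pow_eq_pow_sum,
      Finset.prod_filter, one_mul, sub_sub_cancel]
    refine Finset.prod_congr rfl fun j _ => ?_
    split_ifs with hj
    · rw [edgeIndicator_of_edge hj]; ring
    · rw [edgeIndicator_of_not_edge hj]; ring
  · rw [edgeIndicator_of_not_edge hi]; ring

theorem mem_window_div_of_mem {a b : ℝ} (ha : 0 < a) (hb : 0 < b) {i j t : ℕ+}
    (h1 : i ∈ window a b t) (h2 : i ∈ window a b j) : j ∈ window (a / b) (b / a) t := by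
  rw [mem_window] at h1 h2 ⊢
  rw [div_mul_eq_mul_div, div_mul_eq_mul_div, div_le_iff₀ hb, le_div_iff₀ ha]
  constructor <;> linarith

section

variable {a b : ℝ} {h : ℕ+ → ℕ+ → Prop}

/-- Serves measurability: a finite sum of indicators of edge events is visibly measurable, while the
cardinality of a neighbour set among all vertices is not. -/
theorem vertexDegree_eq_localDegree (ha : 0 < a) (hb : 0 < b)
    (hloc : ∀ i j, h i j → i ∈ window a b j) (t : ℕ+) :
    vertexDegree h t = localDegree a b h t := by
  classical
  unfold vertexDegree localDegree
  rw [← Finset.card_filter, ← Set.ncard_coe_finset]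
  congr 1
  ext j
  simp only [SimpleGraph.mem_neighborSet, intersectionGraph, Finset.coe_filter, Finset.mem_erase,
    Set.mem_ofPred_eq]
  constructor
  · rintro ⟨hne, i, h1, h2⟩
    exact ⟨⟨hne.symm, mem_window_div_of_mem ha hb (hloc _ _ h1) (hloc _ _ h2)⟩,
      i, hloc _ _ h1, h1, h2⟩
  · rintro ⟨⟨hne, -⟩, i, -, h1, h2⟩
    exact ⟨hne.symm, i, h1, h2⟩

/-- Without 4-cycles through v_t, the neighbours reached through different items form disjoint sets,
so no neighbour is counted twice. -/
theorem vertexDegree_eq_pathCount (ha : 0 < a) (hb : 0 < b)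
    (hloc : ∀ i j, h i j → i ∈ window a b j) (t : ℕ+)
    (hcyc : ∀ i i' j, j ≠ t → h i t → h i' t → h i j → h i' j → i = i') :
    vertexDegree h t = pathCount a b h t := by
  classical
  unfold vertexDegree pathCount
  rw [← Finset.card_biUnion, ← Set.ncard_coe_finset]
  · congr 1
    ext j
    simp only [SimpleGraph.mem_neighborSet, intersectionGraph, Finset.coe_biUnion,
      Finset.mem_filter, Finset.mem_erase, Set.mem_iUnion, Finset.mem_coe, exists_prop]
    constructor
    · rintro ⟨hne, i, h1, h2⟩
      exact ⟨i, ⟨hloc _ _ h1, h1⟩, ⟨hne.symm, (mem_window_inv ha hb).2 (hloc _ _ h2)⟩, h2⟩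
    · rintro ⟨i, ⟨-, h1⟩, ⟨hne, -⟩, h2⟩
      exact ⟨hne.symm, i, h1, h2⟩
  · intro i hi i' hi' hne
    rw [Function.onFun, Finset.disjoint_left]
    intro j hj hj'
    simp only [Finset.coe_filter, Set.mem_ofPred_eq, Finset.mem_filter, Finset.mem_erase]
      at hi hi' hj hj'
    exact hne (hcyc i i' j hj.1.1 hi.2 hi'.2 hj.2 hj'.2)

end

theorem cycleCount_nonneg {Ω : Type*} {a b : ℝ} {H : Ω → ℕ+ → ℕ+ → Prop} (t : ℕ+) (ω : Ω) : 0 ≤ cycleCount a b H t ω :=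
  Finset.sum_nonneg fun _ _ => Finset.sum_nonneg fun _ _ => Finset.sum_nonneg fun _ _ =>
    mul_nonneg (mul_nonneg (edgeIndicator_nonneg ..) (edgeIndicator_nonneg ..))
      (mul_nonneg (edgeIndicator_nonneg ..) (edgeIndicator_nonneg ..))

theorem one_le_cycleCount {Ω : Type*} {a b : ℝ} {H : Ω → ℕ+ → ℕ+ → Prop} {t i i' j : ℕ+} {ω : Ω} (hi : i ∈ window a b t) (hi' : i' ∈ window a b t)
    (hj : j ∈ window (a / b) (b / a) t) (hne : i ≠ i') (hjt : j ≠ t)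
    (h1 : H ω i t) (h2 : H ω i' t) (h3 : H ω i j) (h4 : H ω i' j) :
    1 ≤ cycleCount a b H t ω := by
  have hnn (j i i' : ℕ+) : 0 ≤ edgeIndicator H (i, t) ω * edgeIndicator H (i', t) ω *
      (edgeIndicator H (i, j) ω * edgeIndicator H (i', j) ω) :=
    mul_nonneg (mul_nonneg (edgeIndicator_nonneg ..) (edgeIndicator_nonneg ..))
      (mul_nonneg (edgeIndicator_nonneg ..) (edgeIndicator_nonneg ..))
  calc (1 : ℝ) = edgeIndicator H (i, t) ω * edgeIndicator H (i', t) ω *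
      (edgeIndicator H (i, j) ω * edgeIndicator H (i', j) ω) := by
        rw [edgeIndicator_of_edge h1, edgeIndicator_of_edge h2, edgeIndicator_of_edge h3,
          edgeIndicator_of_edge h4]; norm_num
    _ ≤ ∑ i' ∈ (window a b t).erase i, edgeIndicator H (i, t) ω * edgeIndicator H (i', t) ω *
      (edgeIndicator H (i, j) ω * edgeIndicator H (i', j) ω) :=
        Finset.single_le_sum (f := fun i' => edgeIndicator H (i, t) ω * edgeIndicator H (i', t) ω *
          (edgeIndicator H (i, j) ω * edgeIndicator H (i', j) ω)) (fun i' _ => hnn j i i')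
          (Finset.mem_erase.2 ⟨hne.symm, hi'⟩)
    _ ≤ _ := Finset.single_le_sum (f := fun i => ∑ i' ∈ (window a b t).erase i,
        edgeIndicator H (i, t) ω * edgeIndicator H (i', t) ω *
          (edgeIndicator H (i, j) ω * edgeIndicator H (i', j) ω))
          (fun i _ => Finset.sum_nonneg fun i' _ => hnn j i i') hi
    _ ≤ cycleCount a b H t ω := Finset.single_le_sum (f := fun j => ∑ i ∈ window a b t,
        ∑ i' ∈ (window a b t).erase i,
        edgeIndicator H (i, t) ω * edgeIndicator H (i', t) ω *
          (edgeIndicator H (i, j) ω * edgeIndicator H (i', j) ω))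
          (fun j _ => Finset.sum_nonneg fun i _ => Finset.sum_nonneg fun i' _ => hnn j i i')
          (Finset.mem_erase.2 ⟨hjt, hj⟩)

section

variable {Ω : Type*} [MeasurableSpace Ω] {P : Measure Ω} [IsProbabilityMeasure P]
  {a b : ℝ} {X Y : ℕ+ → Ω → ℝ} {H : Ω → ℕ+ → ℕ+ → Prop}

/-- Outside the window the edge probability is 0, and there are only countably many edges. -/
theorem IsRandomBipartiteGraph.ae_edge_mem_window
    (hH : IsRandomBipartiteGraph P a b (fun t => (t : ℝ)) X Y H) :
    ∀ᵐ ω ∂P, ∀ i j, H ω i j → i ∈ window a b j := by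
  rw [ae_all_iff]; intro i; rw [ae_all_iff]; intro j
  by_cases hij : i ∈ window a b j
  · exact Eventually.of_forall fun _ _ => hij
  have h := (hH.hasCondMean_one.mul_edge hH (e := (i, j)) (by simp)).integral_eq hH
  simp only [edgeProb_of_notMem_window hij, mul_zero, integral_zero, one_mul] at h
  rw [integral_eq_zero_iff_of_nonneg (fun ω => edgeIndicator_nonneg H (i, j) ω)] at h
  · filter_upwards [h] with ω hω hHij
    rw [edgeIndicator_of_edge hHij] at hω
    exact absurd hω one_ne_zero
  · exact Integrable.of_bound (hH.measurable_edgeIndicator _).aestronglyMeasurable 1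
      (Eventually.of_forall fun ω => by
        rw [Real.norm_eq_abs, abs_of_nonneg (edgeIndicator_nonneg ..)]
        exact edgeIndicator_le_one ..)

theorem IsRandomBipartiteGraph.aemeasurable_vertexDegree (ha : 0 < a) (hb : 0 < b)
    (hH : IsRandomBipartiteGraph P a b (fun t => (t : ℝ)) X Y H) (t : ℕ+) :
    AEMeasurable (fun ω => vertexDegree (H ω) t) P := by
  classical
  refine ⟨fun ω => localDegree a b (H ω) t, ?_, ?_⟩
  · unfold localDegree
    refine Finset.measurable_fun_sum _ fun j _ => Measurable.ite ?_ measurable_const measurable_const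
    have : {ω | ∃ i ∈ window a b t, H ω i t ∧ H ω i j} =
        ⋃ i ∈ window a b t, ({ω | H ω i t} ∩ {ω | H ω i j}) := by
      ext ω; simp [and_left_comm]
    rw [this]
    exact Finset.measurableSet_biUnion _ fun i _ =>
      (hH.measurableSet_edge i t).inter (hH.measurableSet_edge i j)
  · filter_upwards [hH.ae_edge_mem_window] with ω hω
    exact vertexDegree_eq_localDegree ha hb hω t

/-- Monotonicity of conditional expectation against both arguments of the minimum gives E[min(1, C)
| weights] ≤ min(1, E[C | weights]), and the conditional mean of C is `sharedPairs`. -/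
theorem IsRandomBipartiteGraph.integral_min_cycleCount_le
    (hH : IsRandomBipartiteGraph P a b (fun t => (t : ℝ)) X Y H) (t : ℕ+) :
    ∫ ω, min 1 (cycleCount a b H t ω) ∂P ≤
      ∫ ω, min 1 (sharedPairs a b t (fun i => X i ω) (fun j => Y j ω)) ∂P := by
  have hpm (i i' j : ℕ+) : Measurable fun ω => edgeIndicator H (i, t) ω *
      edgeIndicator H (i', t) ω * (edgeIndicator H (i, j) ω * edgeIndicator H (i', j) ω) := by
    have := hH.measurable_edgeIndicator
    fun_prop
  have hpi (i i' j : ℕ+) : Integrable (fun ω => edgeIndicator H (i, t) ω *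
      edgeIndicator H (i', t) ω * (edgeIndicator H (i, j) ω * edgeIndicator H (i', j) ω)) P := by
    refine Integrable.of_bound (hpm i i' j).aestronglyMeasurable 1 (Eventually.of_forall fun ω => ?_)
    have h0 (e) := edgeIndicator_nonneg H e ω
    have h1 (e) := edgeIndicator_le_one H e ω
    rw [Real.norm_eq_abs, abs_of_nonneg (mul_nonneg (mul_nonneg (h0 _) (h0 _))
      (mul_nonneg (h0 _) (h0 _)))]
    exact mul_le_one₀ (mul_le_one₀ (h1 _) (h0 _) (h1 _)) (mul_nonneg (h0 _) (h0 _))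
      (mul_le_one₀ (h1 _) (h0 _) (h1 _))
  have hci : Integrable (cycleCount a b H t) P :=
    integrable_finsetSum _ fun j _ => integrable_finsetSum _ fun i _ =>
      integrable_finsetSum _ fun i' _ => hpi i i' j
  have hmi : Integrable (fun ω => min 1 (cycleCount a b H t ω)) P :=
    (integrable_const 1).inf hci
  have hce : P[cycleCount a b H t | weightSigma X Y] =ᵐ[P]
      fun ω => sharedPairs a b t (fun i => X i ω) (fun j => Y j ω) := by
    have hfun : cycleCount a b H t = ∑ j ∈ (window (a / b) (b / a) t).erase t,
        ∑ i ∈ window a b t, ∑ i' ∈ (window a b t).erase i, fun ω =>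
          edgeIndicator H (i, t) ω * edgeIndicator H (i', t) ω *
            (edgeIndicator H (i, j) ω * edgeIndicator H (i', j) ω) := by
      ext ω; simp only [cycleCount, Finset.sum_apply]
    have hpair : ∀ j ∈ (window (a / b) (b / a) t).erase t, ∀ i ∈ window a b t,
        ∀ i' ∈ (window a b t).erase i, P[fun ω =>
          edgeIndicator H (i, t) ω * edgeIndicator H (i', t) ω *
            (edgeIndicator H (i, j) ω * edgeIndicator H (i', j) ω) | weightSigma X Y] =ᵐ[P]
          fun ω => edgeProb a b (fun t => (t : ℝ)) (X i ω) (Y t ω) i t *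
            edgeProb a b (fun t => (t : ℝ)) (X i' ω) (Y t ω) i' t *
            (edgeProb a b (fun t => (t : ℝ)) (X i ω) (Y j ω) i j *
              edgeProb a b (fun t => (t : ℝ)) (X i' ω) (Y j ω) i' j) := by
      intro j hj i _ i' hi'
      simpa using (hH.hasCondMean_pair (Finset.ne_of_mem_erase hi')
        (Finset.ne_of_mem_erase hj)).condExp_eq ∅ (by simp)
    rw [hfun]
    refine (condExp_finsetSum (fun j _ => ?_) _).trans ?_
    · exact integrable_finsetSum' _ fun i _ => integrable_finsetSum' _ fun i' _ => hpi i i' j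
    have h2 : ∀ j ∈ (window (a / b) (b / a) t).erase t,
        P[∑ i ∈ window a b t, ∑ i' ∈ (window a b t).erase i, fun ω =>
          edgeIndicator H (i, t) ω * edgeIndicator H (i', t) ω *
            (edgeIndicator H (i, j) ω * edgeIndicator H (i', j) ω) | weightSigma X Y] =ᵐ[P]
        fun ω => ∑ i ∈ window a b t, ∑ i' ∈ (window a b t).erase i,
          edgeProb a b (fun t => (t : ℝ)) (X i ω) (Y t ω) i t *
            edgeProb a b (fun t => (t : ℝ)) (X i' ω) (Y t ω) i' t *
            (edgeProb a b (fun t => (t : ℝ)) (X i ω) (Y j ω) i j *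
              edgeProb a b (fun t => (t : ℝ)) (X i' ω) (Y j ω) i' j) := by
      intro j hj
      refine (condExp_finsetSum (fun i _ => integrable_finsetSum' _ fun i' _ => hpi i i' j) _).trans ?_
      have h3 : ∀ i ∈ window a b t, P[∑ i' ∈ (window a b t).erase i, fun ω =>
          edgeIndicator H (i, t) ω * edgeIndicator H (i', t) ω *
            (edgeIndicator H (i, j) ω * edgeIndicator H (i', j) ω) | weightSigma X Y] =ᵐ[P]
          fun ω => ∑ i' ∈ (window a b t).erase i,
          edgeProb a b (fun t => (t : ℝ)) (X i ω) (Y t ω) i t *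
            edgeProb a b (fun t => (t : ℝ)) (X i' ω) (Y t ω) i' t *
            (edgeProb a b (fun t => (t : ℝ)) (X i ω) (Y j ω) i j *
              edgeProb a b (fun t => (t : ℝ)) (X i' ω) (Y j ω) i' j) := by
        intro i hi
        refine (condExp_finsetSum (fun i' _ => hpi i i' j) _).trans ?_
        have h4 := (Finset.eventually_all _).2 fun i' hi' => hpair j hj i hi i' hi'
        filter_upwards [h4] with ω hω
        rw [Finset.sum_apply]
        exact Finset.sum_congr rfl fun i' hi' => hω i' hi'
      filter_upwards [(Finset.eventually_all _).2 h3] with ω hω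
      rw [Finset.sum_apply]
      exact Finset.sum_congr rfl fun i hi => hω i hi
    filter_upwards [(Finset.eventually_all _).2 h2] with ω hω
    rw [Finset.sum_apply]
    exact Finset.sum_congr rfl fun j hj => hω j hj
  have h1 : P[fun ω => min 1 (cycleCount a b H t ω) | weightSigma X Y] ≤ᵐ[P] fun _ => (1 : ℝ) := by
    have := condExp_mono (m := weightSigma X Y) hmi (integrable_const (1 : ℝ))
      (Eventually.of_forall fun ω => min_le_left _ _)
    rwa [condExp_const hH.weightSigma_le] at this
  have h2 := condExp_mono (m := weightSigma X Y) hmi hci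
    (Eventually.of_forall fun ω => min_le_right _ _)
  rw [← integral_condExp hH.weightSigma_le]
  refine integral_mono_ae integrable_condExp ?_ ?_
  · refine Integrable.of_bound ?_ 1 ?_
    · have hm : Measurable fun ω => ((fun i => X i ω), fun j => Y j ω) :=
        (measurable_pi_iff.2 hH.measurable_X).prodMk (measurable_pi_iff.2 hH.measurable_Y)
      exact (measurable_const.min ((measurable_sharedPairs a b t).comp hm)).aestronglyMeasurable
    · filter_upwards [hH.ae_nonneg] with ω hω
      rw [Real.norm_eq_abs, abs_of_nonneg (le_min zero_le_one (sharedPairs_nonneg hω.1 hω.2 t))]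
      exact min_le_left _ _
  · filter_upwards [h1, h2, hce] with ω h1 h2 h3
    exact le_min h1 (h2.trans_eq h3)

/-- If v_t lies on no 4-cycle the left side vanishes; otherwise the cycle count is at least 1 and
the right side is the trivial bound 1. -/
theorem IsRandomBipartiteGraph.abs_pow_degree_sub_le (ha : 0 < a) (hb : 0 < b)
    (hH : IsRandomBipartiteGraph P a b (fun t => (t : ℝ)) X Y H) {s : ℝ} (hs : 0 ≤ s) (hs1 : s ≤ 1)
    (t : ℕ+) : ∀ᵐ ω ∂P, |s ^ vertexDegree (H ω) t - s ^ pathCount a b (H ω) t| ≤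
      min 1 (cycleCount a b H t ω) := by
  filter_upwards [hH.ae_edge_mem_window] with ω hω
  by_cases hcyc : ∀ i i' j, j ≠ t → H ω i t → H ω i' t → H ω i j → H ω i' j → i = i'
  · rw [vertexDegree_eq_pathCount ha hb hω t hcyc, sub_self, abs_zero]
    exact le_min zero_le_one (cycleCount_nonneg t ω)
  · push Not at hcyc
    obtain ⟨i, i', j, hjt, h1, h2, h3, h4, hne⟩ := hcyc
    rw [min_eq_left (one_le_cycleCount (hω _ _ h1) (hω _ _ h2)
      (mem_window_div_of_mem ha hb (hω _ _ h1) (hω _ _ h3)) hne hjt h1 h2 h3 h4)]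
    have p0 (n : ℕ) := pow_nonneg hs n
    have p1 (n : ℕ) := pow_le_one₀ (n := n) hs hs1
    exact abs_le.2 ⟨by linarith [p0 (vertexDegree (H ω) t), p1 (pathCount a b (H ω) t)],
      by linarith [p1 (vertexDegree (H ω) t), p0 (pathCount a b (H ω) t)]⟩

/-- The probability generating functions of the degrees converge. -/
theorem IsRandomBipartiteGraph.tendsto_integral_pow_degree (ha : 0 < a) (hab : a ≤ b)
    (hH : IsRandomBipartiteGraph P a b (fun t => (t : ℝ)) X Y H)
    (hX : Integrable (fun ω => X 1 ω ^ 2) P) (hY : Integrable (Y 1) P)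
    {s : ℝ} (hs : 0 ≤ s) (hs1 : s ≤ 1) :
    Tendsto (fun t => ∫ ω, s ^ vertexDegree (H ω) t ∂P) atTop
      (𝓝 (∫ ω, Real.exp (-(Y 1 ω * (2 * (√b - √a) * ∫ ω', X 1 ω' * (1 - Real.exp
        (-((1 - s) * (X 1 ω' * (2 * (√a⁻¹ - √b⁻¹) * ∫ ω'', Y 1 ω'' ∂P))))) ∂P))) ∂P)) := by
  have hb := ha.trans_le hab
  have h1 := hH.tendsto_integral_weightPGF ha hab hX hY (u := 1 - s) (by linarith) (by linarith)
  have h2 := hH.tendsto_integral_sharedPairs ha hab hX hY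
  have hcm (t : ℕ+) := hH.hasCondMean_prod_items (1 - s) t (window a b t)
    (fun i => (window b⁻¹ a⁻¹ i).erase t) (fun i => Finset.notMem_erase _ _)
  have h3 (t : ℕ+) : ∫ ω, s ^ pathCount a b (H ω) t ∂P =
      ∫ ω, weightPGF a b (1 - s) t (fun i => X i ω) (fun j => Y j ω) ∂P := by
    simp only [pow_pathCount]
    exact (hcm t).integral_eq hH
  have hpi (t : ℕ+) : Integrable (fun ω => s ^ pathCount a b (H ω) t) P := by
    have := (hcm t).integrable_mul hH ∅
    simpa only [Finset.prod_empty, mul_one, ← pow_pathCount] using this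
  have hdi (t : ℕ+) : Integrable (fun ω => s ^ vertexDegree (H ω) t) P := by
    refine Integrable.of_bound ?_ 1 (Eventually.of_forall fun ω => ?_)
    · exact ((measurable_from_top (f := fun n : ℕ => s ^ n)).comp_aemeasurable
        (hH.aemeasurable_vertexDegree ha hb t)).aestronglyMeasurable
    · rw [Real.norm_eq_abs, abs_of_nonneg (pow_nonneg hs _)]
      exact pow_le_one₀ hs hs1
  refine tendsto_of_tendsto_of_dist h1 (squeeze_zero (fun _ => dist_nonneg) (fun t => ?_) h2)
  rw [← h3, dist_comm, Real.dist_eq, ← integral_sub (hdi t) (hpi t)]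
  refine (abs_integral_le_integral_abs).trans (le_trans ?_ (hH.integral_min_cycleCount_le t))
  refine integral_mono_ae ((hdi t).sub (hpi t)).abs ?_ (hH.abs_pow_degree_sub_le ha hb hs hs1 t)
  refine Integrable.of_bound ?_ 1 (Eventually.of_forall fun ω => ?_)
  · unfold cycleCount
    have := hH.measurable_edgeIndicator
    exact (by fun_prop : Measurable _).aestronglyMeasurable
  · rw [Real.norm_eq_abs, abs_of_nonneg (le_min zero_le_one (cycleCount_nonneg t ω))]
    exact min_le_left _ _

end

/-! ### From generating functions to convergence in distribution -/

theorem integrable_pow_nat (ν : Measure ℕ) [IsProbabilityMeasure ν] {s : ℝ} (hs : 0 ≤ s)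
    (hs1 : s ≤ 1) : Integrable (fun n : ℕ => s ^ n) ν :=
  Integrable.of_bound measurable_from_top.aestronglyMeasurable 1 (Eventually.of_forall fun n => by
    rw [Real.norm_eq_abs, abs_of_nonneg (pow_nonneg hs n)]
    exact pow_le_one₀ hs hs1)

/-- The Taylor remainder of a probability generating function. -/
theorem abs_integral_pow_sub_sum_le (ν : Measure ℕ) [IsProbabilityMeasure ν] {s : ℝ} (hs : 0 ≤ s)
    (hs1 : s ≤ 1) (k : ℕ) :
    |∫ n, s ^ n ∂ν - ∑ j ∈ Finset.range k, ν.real {j} * s ^ j| ≤ s ^ k := by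
  have hind (j : ℕ) : Integrable (Set.indicator {j} fun _ : ℕ => s ^ j) ν :=
    (integrable_const (s ^ j)).indicator (measurableSet_singleton j)
  have hsum : ∑ j ∈ Finset.range k, ν.real {j} * s ^ j =
      ∫ n, ∑ j ∈ Finset.range k, Set.indicator {j} (fun _ : ℕ => s ^ j) n ∂ν := by
    rw [integral_finsetSum _ fun j _ => hind j]
    refine Finset.sum_congr rfl fun j _ => ?_
    rw [integral_indicator_const _ (measurableSet_singleton j), smul_eq_mul]
  rw [hsum, ← integral_sub (integrable_pow_nat ν hs hs1) (integrable_finsetSum _ fun j _ => hind j)]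
  have hb : ∀ n : ℕ, ‖s ^ n - ∑ j ∈ Finset.range k, Set.indicator {j} (fun _ : ℕ => s ^ j) n‖ ≤
      s ^ k := by
    intro n
    rcases lt_or_ge n k with hn | hn
    · rw [Finset.sum_eq_single_of_mem n (Finset.mem_range.2 hn) fun j _ hj =>
        Set.indicator_of_notMem (fun h => hj (Set.mem_singleton_iff.1 h).symm) _,
        Set.indicator_of_mem (Set.mem_singleton n), sub_self, norm_zero]
      positivity
    · rw [Finset.sum_eq_zero fun j hj => Set.indicator_of_notMem (fun h => by
        have h1 := Finset.mem_range.1 hj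
        have h2 := Set.mem_singleton_iff.1 h
        omega) _, sub_zero, Real.norm_eq_abs, abs_of_nonneg (pow_nonneg hs n)]
      exact pow_le_pow_of_le_one hs hs1 hn
  have := norm_integral_le_of_norm_le_const (μ := ν) (Eventually.of_forall hb)
  simpa using this

/-- Masses are recovered by strong induction: after the terms below `k` are subtracted and s^k
divided out, the mass at `k` remains up to an error at most s, uniformly over all probability
measures. A small positive s thus replaces differentiation at 0. -/
theorem tendsto_real_singleton_of_tendsto_pgf {ι : Type*} {l : Filter ι} {ν : ι → Measure ℕ}
    [∀ i, IsProbabilityMeasure (ν i)] {ρ : Measure ℕ} [IsProbabilityMeasure ρ]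
    (h : ∀ s : ℝ, 0 ≤ s → s ≤ 1 → Tendsto (fun i => ∫ n, s ^ n ∂(ν i)) l (𝓝 (∫ n, s ^ n ∂ρ)))
    (k : ℕ) : Tendsto (fun i => (ν i).real {k}) l (𝓝 (ρ.real {k})) := by
  induction k using Nat.strong_induction_on with
  | _ k ih =>
    rw [Metric.tendsto_nhds]
    intro e he
    -- Three errors of size at most s^k · e/4 will be added: one remainder for each measure and one
    -- from convergence at `s`.
    obtain ⟨s, hs0, hs1, hse⟩ : ∃ s : ℝ, 0 < s ∧ s ≤ 1 ∧ s ≤ e / 4 :=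
      ⟨min 1 (e / 4), by positivity, min_le_left _ _, min_le_right _ _⟩
    have hsk : 0 < s ^ k := by positivity
    have hd := (h s hs0.le hs1).sub (tendsto_finsetSum (Finset.range k) fun j hj =>
      (ih j (Finset.mem_range.1 hj)).mul_const (s ^ j))
    have key (κ : Measure ℕ) [IsProbabilityMeasure κ] :
        |(∫ n, s ^ n ∂κ - ∑ j ∈ Finset.range k, κ.real {j} * s ^ j) - κ.real {k} * s ^ k| ≤
          s ^ k * (e / 4) := by
      have := abs_integral_pow_sub_sum_le κ hs0.le hs1 (k + 1)
      rw [Finset.sum_range_succ, ← sub_sub, pow_succ] at this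
      exact this.trans (mul_le_mul_of_nonneg_left hse hsk.le)
    filter_upwards [(Metric.tendsto_nhds.1 hd) (s ^ k * (e / 4)) (by positivity)] with i hi
    rw [Real.dist_eq] at hi ⊢
    have h1 := key (ν i)
    have h2 := key ρ
    have h3 : |(ν i).real {k} - ρ.real {k}| * s ^ k < e * s ^ k := by
      rw [← abs_of_pos hsk, ← abs_mul, abs_of_pos hsk, sub_mul]
      rw [abs_le] at h1 h2
      rw [abs_lt] at hi ⊢
      constructor <;> nlinarith
    exact lt_of_mul_lt_mul_right h3 hsk.le

/-- Convergence of probability generating functions on `[0, 1]` implies convergence in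
distribution. -/
theorem tendstoInDistribution_of_tendsto_pgf {ι Ω Ω' : Type*} [MeasurableSpace Ω]
    [MeasurableSpace Ω'] {l : Filter ι} [l.IsCountablyGenerated] {P : Measure Ω}
    [IsProbabilityMeasure P] {Q : Measure Ω'} [IsProbabilityMeasure Q] {N : ι → Ω → ℕ} {Z : Ω' → ℕ}
    (hN : ∀ i, AEMeasurable (N i) P) (hZ : AEMeasurable Z Q)
    (h : ∀ s : ℝ, 0 ≤ s → s ≤ 1 →
      Tendsto (fun i => ∫ ω, s ^ N i ω ∂P) l (𝓝 (∫ ω, s ^ Z ω ∂Q))) :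
    TendstoInDistribution N l Z (fun _ => P) Q := by
  refine ⟨hN, hZ, ?_⟩
  have (i : ι) : IsProbabilityMeasure (P.map (N i)) := Measure.isProbabilityMeasure_map (hN i)
  have : IsProbabilityMeasure (Q.map Z) := Measure.isProbabilityMeasure_map hZ
  have hk := tendsto_real_singleton_of_tendsto_pgf (l := l) (ν := fun i => P.map (N i))
    (ρ := Q.map Z) fun s hs hs1 => by
      simpa only [integral_map hZ (measurable_from_top (f := fun n : ℕ => s ^ n)).aestronglyMeasurable,
        fun i => integral_map (hN i)
          (measurable_from_top (f := fun n : ℕ => s ^ n)).aestronglyMeasurable] using h s hs hs1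
  -- In discrete ℕ the singletons, with the empty set added, form a π-system containing a
  -- neighbourhood of every point, so convergence of point masses is enough.
  refine IsPiSystem.tendsto_probabilityMeasure_of_tendsto_of_mem
    (S := {A | A = ∅ ∨ ∃ k : ℕ, A = {k}}) ?_ (fun s _ => MeasurableSet.of_discrete) ?_ ?_
  · rintro A (rfl | ⟨k, rfl⟩) B hB hne
    · simp at hne
    · obtain ⟨x, hx1, hx2⟩ := hne
      rw [Set.mem_singleton_iff] at hx1
      subst hx1
      exact Or.inr ⟨x, Set.inter_eq_left.2 (Set.singleton_subset_iff.2 hx2)⟩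
  · intro u _ x hx
    exact ⟨{x}, Or.inr ⟨x, rfl⟩, by simp [nhds_discrete], Set.singleton_subset_iff.2 hx⟩
  · rintro A (rfl | ⟨k, rfl⟩)
    · simpa using tendsto_const_nhds
    · rw [← NNReal.tendsto_coe]
      exact hk k

/-! ### Mixed Poisson laws -/

section MixedPoisson

variable {Ω : Type*} [MeasurableSpace Ω] {P : Measure Ω} [IsProbabilityMeasure P] {lam : Ω → ℝ}

theorem poisson_weight_nonneg {l : ℝ} (hl : 0 ≤ l) (r : ℕ) :
    0 ≤ Real.exp (-l) * l ^ r / (r.factorial : ℝ) := by positivity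

theorem hasSum_poisson_weight_mul_pow (g l : ℝ) :
    HasSum (fun r : ℕ => g ^ r * (Real.exp (-l) * l ^ r / (r.factorial : ℝ)))
      (Real.exp (-(l * (1 - g)))) := by
  have h := (NormedSpace.expSeries_div_hasSum_exp (g * l)).mul_left (Real.exp (-l))
  rw [← Real.exp_eq_exp_ℝ, ← Real.exp_add, show -l + g * l = -(l * (1 - g)) by ring] at h
  refine h.congr_fun fun r => ?_
  rw [mul_pow]; ring

theorem hasSum_poisson_weight_mul_deriv_pow (g l : ℝ) :
    HasSum (fun r : ℕ => (r * g ^ (r - 1)) * (Real.exp (-l) * l ^ r / (r.factorial : ℝ)))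
      (l * Real.exp (-(l * (1 - g)))) := by
  rw [← hasSum_nat_add_iff' 1]
  simp only [Finset.range_one, Finset.sum_singleton, Nat.cast_zero, zero_mul, sub_zero,
    Nat.add_sub_cancel]
  refine ((hasSum_poisson_weight_mul_pow g l).mul_left l).congr_fun fun r => ?_
  have h1 : (r.factorial : ℝ) ≠ 0 := by exact_mod_cast r.factorial_ne_zero
  have h2 : ((r : ℝ) + 1) ≠ 0 := by positivity
  rw [Nat.factorial_succ]
  push_cast
  field_simp
  ring

/-- Tonelli for nonnegative terms; working in `ENNReal` avoids any integrability assumption on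
`lam`. -/
theorem tsum_ofReal_mul_mixedPoisson (hm : Measurable lam) (h0 : ∀ᵐ ω ∂P, 0 ≤ lam ω)
    {f : ℕ → ℝ} {F : ℝ → ℝ} (hf : ∀ r, 0 ≤ f r) (hF : ∀ l, 0 ≤ l →
      HasSum (fun r : ℕ => f r * (Real.exp (-l) * l ^ r / (r.factorial : ℝ))) (F l)) :
    ∑' r : ℕ, ENNReal.ofReal (f r) *
      ENNReal.ofReal (∫ ω, Real.exp (-lam ω) * lam ω ^ r / (r.factorial : ℝ) ∂P) =
      ∫⁻ ω, ENNReal.ofReal (F (lam ω)) ∂P := by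
  have hmr (r : ℕ) : Measurable fun ω => Real.exp (-lam ω) * lam ω ^ r / (r.factorial : ℝ) := by
    fun_prop
  have hint (r : ℕ) : Integrable (fun ω => Real.exp (-lam ω) * lam ω ^ r / (r.factorial : ℝ)) P := by
    refine Integrable.of_bound (hmr r).aestronglyMeasurable 1 ?_
    filter_upwards [h0] with ω hω
    have h := hasSum_poisson_weight_mul_pow 1 (lam ω)
    simp only [one_pow, one_mul, sub_self, mul_zero, neg_zero, Real.exp_zero] at h
    rw [Real.norm_eq_abs, abs_of_nonneg (poisson_weight_nonneg hω r)]
    exact le_hasSum h r fun k _ => poisson_weight_nonneg hω k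
  have h1 (r : ℕ) : ENNReal.ofReal (f r) *
      ENNReal.ofReal (∫ ω, Real.exp (-lam ω) * lam ω ^ r / (r.factorial : ℝ) ∂P) =
      ∫⁻ ω, ENNReal.ofReal (f r * (Real.exp (-lam ω) * lam ω ^ r / (r.factorial : ℝ))) ∂P := by
    rw [ofReal_integral_eq_lintegral_ofReal (hint r)
      (h0.mono fun ω hω => poisson_weight_nonneg hω r), ← lintegral_const_mul _ (hmr r).ennreal_ofReal]
    simp only [ENNReal.ofReal_mul (hf r)]
  simp only [h1]
  rw [← lintegral_tsum fun r => ((hmr r).const_mul (f r)).ennreal_ofReal.aemeasurable]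
  refine lintegral_congr_ae ?_
  filter_upwards [h0] with ω hω
  have h := hF (lam ω) hω
  rw [← ENNReal.ofReal_tsum_of_nonneg (fun r => mul_nonneg (hf r) (poisson_weight_nonneg hω r))
    h.summable, h.tsum_eq]

variable {Ω' : Type*} [MeasurableSpace Ω'] {Q : Measure Ω'} [IsProbabilityMeasure Q] {Λ : Ω' → ℕ}

theorem lintegral_ofReal_nat {N : Ω' → ℕ} (hN : Measurable N) (f : ℕ → ℝ) :
    ∫⁻ ω, ENNReal.ofReal (f (N ω)) ∂Q =
      ∑' r : ℕ, ENNReal.ofReal (f r) * ENNReal.ofReal (Q.real {ω | N ω = r}) := by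
  rw [← lintegral_map (f := fun n => ENNReal.ofReal (f n)) measurable_from_top hN,
    lintegral_countable']
  refine tsum_congr fun r => ?_
  rw [Measure.map_apply hN (measurableSet_singleton r), ofReal_measureReal]
  rfl

theorem IsMixedPoisson.lintegral_eq (h : IsMixedPoisson Q Λ P lam)
    (hm : Measurable lam) (h0 : ∀ᵐ ω ∂P, 0 ≤ lam ω)
    {f : ℕ → ℝ} {F : ℝ → ℝ} (hf : ∀ r, 0 ≤ f r) (hF : ∀ l, 0 ≤ l →
      HasSum (fun r : ℕ => f r * (Real.exp (-l) * l ^ r / (r.factorial : ℝ))) (F l)) :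
    ∫⁻ ω, ENNReal.ofReal (f (Λ ω)) ∂Q = ∫⁻ ω, ENNReal.ofReal (F (lam ω)) ∂P := by
  rw [lintegral_ofReal_nat h.measurable, ← tsum_ofReal_mul_mixedPoisson hm h0 hf hF]
  simp only [h.prob_eq]

/-- Yields at once the generating function, its derivative and the mean. Both Bochner integrals are
read off from the same `lintegral`, so the identity holds even when that is infinite. -/
theorem IsMixedPoisson.integral_eq (h : IsMixedPoisson Q Λ P lam)
    (hm : Measurable lam) (h0 : ∀ᵐ ω ∂P, 0 ≤ lam ω)
    {f : ℕ → ℝ} {F : ℝ → ℝ} (hf : ∀ r, 0 ≤ f r) (hFm : Measurable F) (hF : ∀ l, 0 ≤ l →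
      HasSum (fun r : ℕ => f r * (Real.exp (-l) * l ^ r / (r.factorial : ℝ))) (F l)) :
    ∫ ω, f (Λ ω) ∂Q = ∫ ω, F (lam ω) ∂P := by
  have hnn : 0 ≤ᵐ[P] fun ω => F (lam ω) := by
    filter_upwards [h0] with ω hω
    exact (hF _ hω).nonneg fun r => mul_nonneg (hf r) (poisson_weight_nonneg hω r)
  rw [integral_eq_lintegral_of_nonneg_ae (Eventually.of_forall fun ω => hf _)
    ((measurable_from_top (f := f)).comp h.measurable).aestronglyMeasurable,
    integral_eq_lintegral_of_nonneg_ae hnn (hFm.comp hm).aestronglyMeasurable,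
    h.lintegral_eq hm h0 hf hF]

theorem IsMixedPoisson.integral_pow (h : IsMixedPoisson Q Λ P lam)
    (hm : Measurable lam) (h0 : ∀ᵐ ω ∂P, 0 ≤ lam ω) {g : ℝ} (hg : 0 ≤ g) :
    ∫ ω, g ^ Λ ω ∂Q = ∫ ω, Real.exp (-(lam ω * (1 - g))) ∂P :=
  h.integral_eq hm h0 (f := fun r => g ^ r) (F := fun l => Real.exp (-(l * (1 - g))))
    (fun r => pow_nonneg hg r) (by fun_prop) fun l _ => hasSum_poisson_weight_mul_pow g l

theorem IsMixedPoisson.integral_deriv_pow (h : IsMixedPoisson Q Λ P lam)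
    (hm : Measurable lam) (h0 : ∀ᵐ ω ∂P, 0 ≤ lam ω) {g : ℝ} (hg : 0 ≤ g) :
    ∫ ω, (Λ ω : ℝ) * g ^ (Λ ω - 1) ∂Q = ∫ ω, lam ω * Real.exp (-(lam ω * (1 - g))) ∂P :=
  h.integral_eq hm h0 (f := fun r => (r : ℝ) * g ^ (r - 1))
    (F := fun l => l * Real.exp (-(l * (1 - g))))
    (fun r => by positivity) (by fun_prop) fun l _ => hasSum_poisson_weight_mul_deriv_pow g l

theorem IsMixedPoisson.integral_self (h : IsMixedPoisson Q Λ P lam)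
    (hm : Measurable lam) (h0 : ∀ᵐ ω ∂P, 0 ≤ lam ω) :
    ∫ ω, (Λ ω : ℝ) ∂Q = ∫ ω, lam ω ∂P := by
  simpa using h.integral_deriv_pow hm h0 zero_le_one

end MixedPoisson

/-! ### Random sums and size biasing -/

section Compound

variable {Ω Ω' : Type*} [MeasurableSpace Ω] [MeasurableSpace Ω'] {P : Measure Ω}
  {Q : Measure Ω'} {lam₁ lam₂ : Ω → ℝ} {Λ₁ Λ₂ : Ω' → ℕ} {ϰ : ℕ → Ω' → ℕ}

theorem measurable_sum_range_nat :
    Measurable (fun q : ℕ × (ℕ → ℕ) => ∑ j ∈ Finset.range q.1, q.2 j) :=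
  measurable_from_prod_countable_right fun n => by
    dsimp only
    fun_prop

theorem IsCompoundFamily.measurable_sum (h : IsCompoundFamily P lam₁ lam₂ Q Λ₁ Λ₂ ϰ) :
    Measurable (fun ω => ∑ j ∈ Finset.range (Λ₁ ω), ϰ j ω) :=
  measurable_sum_range_nat.comp (h.mixedPoisson₁.measurable.prodMk (measurable_pi_iff.2 h.measurable_ϰ))

/-- The probability generating function of a random sum. -/
theorem IsCompoundFamily.integral_pow_sum [IsProbabilityMeasure Q]
    (h : IsCompoundFamily P lam₁ lam₂ Q Λ₁ Λ₂ ϰ)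
    {s : ℝ} (hs : 0 ≤ s) (hs1 : s ≤ 1) :
    ∫ ω, s ^ (∑ j ∈ Finset.range (Λ₁ ω), ϰ j ω) ∂Q = ∫ ω, (∫ ω', s ^ ϰ 0 ω' ∂Q) ^ Λ₁ ω ∂Q := by
  have hΛ := h.mixedPoisson₁.measurable
  have hϰ : Measurable (fun ω j => ϰ j ω) := measurable_pi_iff.2 h.measurable_ϰ
  have : IsProbabilityMeasure (Q.map Λ₁) := Measure.isProbabilityMeasure_map hΛ.aemeasurable
  have : IsProbabilityMeasure (Q.map (fun ω j => ϰ j ω)) :=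
    Measure.isProbabilityMeasure_map hϰ.aemeasurable
  have hFm : Measurable (fun q : ℕ × (ℕ → ℕ) => s ^ (∑ j ∈ Finset.range q.1, q.2 j)) :=
    (measurable_from_top (f := fun n : ℕ => s ^ n)).comp measurable_sum_range_nat
  have hlaw := (indepFun_iff_map_prod_eq_prod_map_map hΛ.aemeasurable hϰ.aemeasurable).1 h.indep_Λ₁_ϰ
  have e1 := integral_map (μ := Q) (hΛ.prodMk hϰ).aemeasurable hFm.aestronglyMeasurable
  -- By independence the law of (Λ₁, ϰ) is a product, so the sum may be averaged with the number of
  -- terms fixed.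
  rw [hlaw, integral_prod] at e1
  swap
  · refine Integrable.of_bound hFm.aestronglyMeasurable 1 (Eventually.of_forall fun q => ?_)
    rw [Real.norm_eq_abs, abs_of_nonneg (pow_nonneg hs _)]
    exact pow_le_one₀ hs hs1
  refine e1.symm.trans ?_
  rw [← integral_map (μ := Q) (φ := Λ₁) (f := fun n => (∫ ω', s ^ ϰ 0 ω' ∂Q) ^ n) hΛ.aemeasurable
    measurable_from_top.aestronglyMeasurable]
  refine integral_congr_ae (Eventually.of_forall fun n => ?_)
  have hFn : Measurable (fun k : ℕ → ℕ => s ^ (∑ j ∈ Finset.range n, k j)) :=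
    hFm.comp (measurable_const.prodMk measurable_id)
  dsimp only
  rw [integral_map hϰ.aemeasurable hFn.aestronglyMeasurable]
  simp only [← Finset.prod_pow_eq_pow_sum, Finset.prod_range]
  have hind : iIndepFun (fun j : Fin n => ϰ j) Q := h.iIndep_ϰ.precomp Fin.val_injective
  rw [hind.integral_fun_prod_comp (fun j => (h.measurable_ϰ j).aemeasurable)
    (f := fun _ k => s ^ k) fun j => measurable_from_top.aestronglyMeasurable]
  have hj (j : Fin n) : ∫ ω, s ^ ϰ j ω ∂Q = ∫ ω, s ^ ϰ 0 ω ∂Q :=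
    ((h.identDistrib_ϰ j).comp (u := fun k : ℕ => s ^ k) measurable_from_top).integral_eq
  rw [Finset.prod_congr rfl fun j _ => hj j, Finset.prod_const, Finset.card_univ, Fintype.card_fin]

/-- The probability generating function of the size-biased distribution. -/
theorem IsCompoundFamily.integral_pow_mul [IsProbabilityMeasure Q]
    (h : IsCompoundFamily P lam₁ lam₂ Q Λ₁ Λ₂ ϰ)
    (hE : (∫ ω, (Λ₂ ω : ℝ) ∂Q) ≠ 0) {s : ℝ} (hs : 0 ≤ s) :
    (∫ ω, s ^ ϰ 0 ω ∂Q) * ∫ ω, (Λ₂ ω : ℝ) ∂Q = ∫ ω, (Λ₂ ω : ℝ) * s ^ (Λ₂ ω - 1) ∂Q := by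
  set E := ∫ ω, (Λ₂ ω : ℝ) ∂Q
  have hE0 : 0 < E := lt_of_le_of_ne (integral_nonneg fun ω => Nat.cast_nonneg _) hE.symm
  have key : (∫⁻ ω, ENNReal.ofReal (s ^ ϰ 0 ω) ∂Q) * ENNReal.ofReal E =
      ∫⁻ ω, ENNReal.ofReal ((Λ₂ ω : ℝ) * s ^ (Λ₂ ω - 1)) ∂Q := by
    rw [lintegral_ofReal_nat (h.measurable_ϰ 0) (fun r => s ^ r),
      lintegral_ofReal_nat h.mixedPoisson₂.measurable (fun r => (r : ℝ) * s ^ (r - 1)),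
      -- The term r = 0 vanishes, and the shift r + 1 is exactly the one in the size-biased law.
      tsum_eq_zero_add' (f := fun r : ℕ => ENNReal.ofReal ((r : ℝ) * s ^ (r - 1)) *
        ENNReal.ofReal (Q.real {ω | Λ₂ ω = r})) ENNReal.summable, ← ENNReal.tsum_mul_right]
    simp only [Nat.cast_zero, zero_mul, ENNReal.ofReal_zero, zero_add]
    refine tsum_congr fun r => ?_
    have hp : Q.real {ω | ϰ 0 ω = r} = ((r : ℝ) + 1) / E * Q.real {ω | Λ₂ ω = r + 1} :=
      h.prob_ϰ hE 0 r
    rw [hp, ← ENNReal.ofReal_mul (by positivity), ← ENNReal.ofReal_mul (by positivity),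
      ← ENNReal.ofReal_mul (by positivity)]
    congr 1
    rw [Nat.add_sub_cancel]
    push_cast
    field_simp
  rw [integral_eq_lintegral_of_nonneg_ae (Eventually.of_forall fun ω => pow_nonneg hs _)
    ((measurable_from_top (f := fun n : ℕ => s ^ n)).comp (h.measurable_ϰ 0)).aestronglyMeasurable,
    integral_eq_lintegral_of_nonneg_ae (Eventually.of_forall fun ω =>
      mul_nonneg (Nat.cast_nonneg _) (pow_nonneg hs _))
    ((measurable_from_top (f := fun n : ℕ => (n : ℝ) * s ^ (n - 1))).comp
      h.mixedPoisson₂.measurable).aestronglyMeasurable, ← key, ENNReal.toReal_mul,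
    ENNReal.toReal_ofReal hE0.le]

theorem exists_measure_nat {p : ℕ → ℝ} (hp : ∀ r, 0 ≤ p r)
    (hsum : ∑' r, ENNReal.ofReal (p r) = 1) :
    ∃ μ : Measure ℕ, IsProbabilityMeasure μ ∧ ∀ r, μ.real {r} = p r := by
  let q : PMF ℕ := ⟨fun r => ENNReal.ofReal (p r), ENNReal.summable.hasSum_iff.2 hsum⟩
  refine ⟨q.toMeasure, inferInstance, fun r => ?_⟩
  rw [measureReal_def, PMF.toMeasure_apply_singleton _ _ (measurableSet_singleton r)]
  exact ENNReal.toReal_ofReal (hp r)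

theorem exists_mixedPoisson_measure [IsProbabilityMeasure P] {lam : Ω → ℝ} (hm : Measurable lam) (h0 : ∀ᵐ ω ∂P, 0 ≤ lam ω) :
    ∃ μ : Measure ℕ, IsProbabilityMeasure μ ∧ ∀ r : ℕ, μ.real {r} =
      ∫ ω, Real.exp (-lam ω) * lam ω ^ r / (r.factorial : ℝ) ∂P := by
  refine exists_measure_nat (fun r => integral_nonneg_of_ae ?_) ?_
  · filter_upwards [h0] with ω hω using poisson_weight_nonneg hω r
  · have := tsum_ofReal_mul_mixedPoisson (P := P) hm h0 (f := fun r => 1 ^ r)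
      (F := fun l => Real.exp (-(l * (1 - 1)))) (fun r => by positivity)
      fun l _ => hasSum_poisson_weight_mul_pow 1 l
    simpa using this

theorem isMixedPoisson_of_map {lam : Ω → ℝ} {μ : Measure ℕ} (hμ : ∀ r : ℕ, μ.real {r} =
      ∫ ω, Real.exp (-lam ω) * lam ω ^ r / (r.factorial : ℝ) ∂P) {Λ : Ω' → ℕ} (hΛ : Measurable Λ)
    (hmap : Q.map Λ = μ) : IsMixedPoisson Q Λ P lam := by
  refine ⟨hΛ, fun r => ?_⟩
  rw [← hμ, ← hmap, map_measureReal_apply hΛ (measurableSet_singleton r)]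
  rfl

/-- The variables are coordinates on a product space. The size-biased weights have total mass 1
because ∑ r P(Λ₂ = r) equals the mean of λ₂, which is finite. -/
theorem exists_isCompoundFamily [IsProbabilityMeasure P] (hm₁ : Measurable lam₁) (h₁ : ∀ᵐ ω ∂P, 0 ≤ lam₁ ω)
    (hm₂ : Measurable lam₂) (h₂ : ∀ᵐ ω ∂P, 0 ≤ lam₂ ω) (hint : Integrable lam₂ P) :
    ∃ (Ω' : Type) (_ : MeasurableSpace Ω') (Q : Measure Ω') (_ : IsProbabilityMeasure Q)
      (Λ₁ Λ₂ : Ω' → ℕ) (ϰ : ℕ → Ω' → ℕ), IsCompoundFamily P lam₁ lam₂ Q Λ₁ Λ₂ ϰ := by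
  obtain ⟨μ₁, hμ₁, hp₁⟩ := exists_mixedPoisson_measure hm₁ h₁
  obtain ⟨μ₂, hμ₂, hp₂⟩ := exists_mixedPoisson_measure hm₂ h₂
  set E := ∫ ω, lam₂ ω ∂P
  have hE : 0 ≤ E := integral_nonneg_of_ae h₂
  obtain ⟨μ₃, hμ₃, hp₃⟩ : ∃ μ₃ : Measure ℕ, IsProbabilityMeasure μ₃ ∧
      (E ≠ 0 → ∀ r : ℕ, μ₃.real {r} = ((r : ℝ) + 1) / E * μ₂.real {r + 1}) := by
    by_cases hE0 : E = 0
    -- With mean zero nothing is prescribed, and any probability measure serves.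
    · exact ⟨Measure.dirac 0, inferInstance, fun h => absurd hE0 h⟩
    have hEpos : 0 < E := lt_of_le_of_ne hE (Ne.symm hE0)
    obtain ⟨μ₃, h3, h4⟩ := exists_measure_nat
      (p := fun r => ((r : ℝ) + 1) / E * μ₂.real {r + 1}) (fun r => by positivity) (by
        have := tsum_ofReal_mul_mixedPoisson (P := P) hm₂ h₂ (f := fun r => (r : ℝ) * 1 ^ (r - 1))
          (F := fun l => l * Real.exp (-(l * (1 - 1)))) (fun r => by positivity)
          fun l _ => hasSum_poisson_weight_mul_deriv_pow 1 l
        simp only [one_pow, mul_one, sub_self, mul_zero, neg_zero, Real.exp_zero] at this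
        rw [← ofReal_integral_eq_lintegral_ofReal hint h₂, tsum_eq_zero_add' ENNReal.summable] at this
        simp only [Nat.cast_zero, ENNReal.ofReal_zero, zero_mul, zero_add, ← hp₂] at this
        calc ∑' r : ℕ, ENNReal.ofReal (((r : ℝ) + 1) / E * μ₂.real {r + 1})
            = ∑' r : ℕ, ENNReal.ofReal E⁻¹ * (ENNReal.ofReal ((r + 1 : ℕ) : ℝ) *
                ENNReal.ofReal (μ₂.real {r + 1})) := by
              refine tsum_congr fun r => ?_
              rw [← ENNReal.ofReal_mul (by positivity), ← ENNReal.ofReal_mul (by positivity)]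
              congr 1
              push_cast
              ring
          _ = 1 := by
              rw [ENNReal.tsum_mul_left, this, ← ENNReal.ofReal_mul (by positivity),
                inv_mul_cancel₀ hE0, ENNReal.ofReal_one])
    exact ⟨μ₃, h3, fun _ => h4⟩
  set Q := (μ₁.prod μ₂).prod (Measure.infinitePi fun _ : ℕ => μ₃)
  have hΛ₁ : Q.map (fun ω => ω.1.1) = μ₁ := by
    rw [show (fun ω : (ℕ × ℕ) × (ℕ → ℕ) => ω.1.1) = Prod.fst ∘ Prod.fst from rfl,
      ← Measure.map_map measurable_fst measurable_fst, Measure.map_fst_prod, measure_univ, one_smul,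
      Measure.map_fst_prod, measure_univ, one_smul]
  have hΛ₂ : Q.map (fun ω => ω.1.2) = μ₂ := by
    rw [show (fun ω : (ℕ × ℕ) × (ℕ → ℕ) => ω.1.2) = Prod.snd ∘ Prod.fst from rfl,
      ← Measure.map_map measurable_snd measurable_fst, Measure.map_fst_prod, measure_univ, one_smul,
      Measure.map_snd_prod, measure_univ, one_smul]
  have hϰ : Q.map (fun ω => ω.2) = Measure.infinitePi fun _ : ℕ => μ₃ := by
    rw [Measure.map_snd_prod, measure_univ, one_smul]
  have hϰj (j : ℕ) : Q.map (fun ω => ω.2 j) = μ₃ := by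
    rw [show (fun ω : (ℕ × ℕ) × (ℕ → ℕ) => ω.2 j) = (fun k => k j) ∘ Prod.snd from rfl,
      ← Measure.map_map (measurable_pi_apply j) measurable_snd, hϰ, Measure.infinitePi_map_eval]
  have hm₁' : Measurable (fun ω : (ℕ × ℕ) × (ℕ → ℕ) => ω.1.1) := measurable_fst.comp measurable_fst
  have hm₂' : Measurable (fun ω : (ℕ × ℕ) × (ℕ → ℕ) => ω.1.2) := measurable_snd.comp measurable_fst
  have hm₃' (j : ℕ) : Measurable (fun ω : (ℕ × ℕ) × (ℕ → ℕ) => ω.2 j) :=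
    (measurable_pi_apply j).comp measurable_snd
  have hP₂ : IsMixedPoisson Q (fun ω => ω.1.2) P lam₂ := isMixedPoisson_of_map hp₂ hm₂' hΛ₂
  refine ⟨(ℕ × ℕ) × (ℕ → ℕ), inferInstance, Q, inferInstance, fun ω => ω.1.1, fun ω => ω.1.2,
    fun j ω => ω.2 j, ⟨isMixedPoisson_of_map hp₁ hm₁' hΛ₁, hP₂, hm₃', ?_, ?_, ?_, ?_⟩⟩
  · rw [iIndepFun_iff_map_fun_eq_infinitePi_map hm₃']
    simp only [hϰj]
    exact hϰ
  · exact fun j => ⟨(hm₃' j).aemeasurable, (hm₃' 0).aemeasurable, by rw [hϰj, hϰj]⟩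
  · exact indepFun_prod (X := fun q : ℕ × ℕ => q.1) (Y := fun k : ℕ → ℕ => k) measurable_fst
      measurable_id
  · rw [hP₂.integral_self hm₂ h₂]
    intro hE0 j r
    have e1 : Q.real {ω | ω.2 j = r} = μ₃.real {r} := by
      rw [← hϰj j, map_measureReal_apply (hm₃' j) (measurableSet_singleton r)]
      rfl
    have e2 : Q.real {ω | ω.1.2 = r + 1} = μ₂.real {r + 1} := by
      rw [← hΛ₂, map_measureReal_apply hm₂' (measurableSet_singleton _)]
      rfl
    rw [e1, e2]
    exact hp₃ hE0 r

end Compound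

/-! ### Generating function of the limit and the conclusion -/

section Limit

variable {Ω Ω' : Type*} [MeasurableSpace Ω] [MeasurableSpace Ω'] {P : Measure Ω}
  [IsProbabilityMeasure P] {Q : Measure Ω'} [IsProbabilityMeasure Q]
  {lam₁ lam₂ : Ω → ℝ} {Λ₁ Λ₂ : Ω' → ℕ} {ϰ : ℕ → Ω' → ℕ}

/-- The probability generating function of the compound distribution, when the random means are
proportional to integrable non-negative variables `y` and `x`. -/
theorem IsCompoundFamily.integral_pow_sum_eq (h : IsCompoundFamily P lam₁ lam₂ Q Λ₁ Λ₂ ϰ)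
    {x y : Ω → ℝ} (hx : Integrable x P) (hxm : Measurable x) (hym : Measurable y)
    (hy : Integrable y P) (hx0 : ∀ᵐ ω ∂P, 0 ≤ x ω) (hy0 : ∀ᵐ ω ∂P, 0 ≤ y ω)
    {κ₁ κ₂ : ℝ} (hκ₁ : 0 ≤ κ₁) (hκ₂ : 0 < κ₂) (h₁ : ∀ ω, lam₁ ω = κ₁ * (∫ ω', x ω' ∂P) * y ω)
    (h₂ : ∀ ω, lam₂ ω = κ₂ * (∫ ω', y ω' ∂P) * x ω) {s : ℝ} (hs : 0 ≤ s) (hs1 : s ≤ 1) :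
    ∫ ω, s ^ (∑ j ∈ Finset.range (Λ₁ ω), ϰ j ω) ∂Q =
      ∫ ω, Real.exp (-(y ω * (κ₁ * ∫ ω', x ω' *
        (1 - Real.exp (-((1 - s) * (x ω' * (κ₂ * ∫ ω'', y ω'' ∂P))))) ∂P))) ∂P := by
  set a₁ := ∫ ω, x ω ∂P
  set b₁ := ∫ ω, y ω ∂P
  have ha₁ : 0 ≤ a₁ := integral_nonneg_of_ae hx0
  have hb₁ : 0 ≤ b₁ := integral_nonneg_of_ae hy0
  have hm₁ : Measurable lam₁ := by rw [funext h₁]; fun_prop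
  have hm₂ : Measurable lam₂ := by rw [funext h₂]; fun_prop
  have hn₁ : ∀ᵐ ω ∂P, 0 ≤ lam₁ ω := by
    filter_upwards [hy0] with ω hω; rw [h₁]; positivity
  have hn₂ : ∀ᵐ ω ∂P, 0 ≤ lam₂ ω := by
    filter_upwards [hx0] with ω hω; rw [h₂]; positivity
  set g := ∫ ω', s ^ ϰ 0 ω' ∂Q
  have hg : 0 ≤ g := integral_nonneg fun _ => pow_nonneg hs _
  rw [h.integral_pow_sum hs hs1, h.mixedPoisson₁.integral_pow hm₁ hn₁ hg]
  refine integral_congr_ae ?_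
  have hE : ∫ ω, (Λ₂ ω : ℝ) ∂Q = κ₂ * b₁ * a₁ := by
    rw [h.mixedPoisson₂.integral_self hm₂ hn₂, funext h₂, integral_const_mul]
  have hexpm : AEStronglyMeasurable
      (fun ω => x ω * Real.exp (-((1 - s) * (x ω * (κ₂ * b₁))))) P :=
    (by fun_prop : Measurable _).aestronglyMeasurable
  have hexp : Integrable (fun ω => x ω * Real.exp (-((1 - s) * (x ω * (κ₂ * b₁))))) P := by
    refine hx.mono hexpm ?_
    filter_upwards [hx0] with ω hω
    rw [norm_mul, Real.norm_of_nonneg (Real.exp_pos _).le]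
    refine mul_le_of_le_one_right (norm_nonneg _) (Real.exp_le_one_iff.2 (neg_nonpos.2 ?_))
    have : 0 ≤ 1 - s := by linarith
    positivity
  have hR : ∫ ω', x ω' * (1 - Real.exp (-((1 - s) * (x ω' * (κ₂ * b₁))))) ∂P =
      a₁ - ∫ ω', x ω' * Real.exp (-((1 - s) * (x ω' * (κ₂ * b₁)))) ∂P := by
    rw [← integral_sub hx hexp]
    simp only [mul_sub, mul_one]
  -- When `a₁` or `b₁` vanishes, both exponents are almost surely 0, so the unspecified value of `g`
  -- does not matter.
  by_cases ha : a₁ = 0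
  · have hx' : ∀ᵐ ω ∂P, x ω = 0 := (integral_eq_zero_iff_of_nonneg_ae hx0 hx).1 ha
    have hR0 : ∫ ω', x ω' * (1 - Real.exp (-((1 - s) * (x ω' * (κ₂ * b₁))))) ∂P = 0 :=
      integral_eq_zero_of_ae (by filter_upwards [hx'] with ω hω; simp [hω])
    exact Eventually.of_forall fun ω => by simp [h₁, ha, hR0]
  by_cases hb : b₁ = 0
  · have hy' : ∀ᵐ ω ∂P, y ω = 0 := (integral_eq_zero_iff_of_nonneg_ae hy0 hy).1 hb
    filter_upwards [hy'] with ω hω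
    simp [h₁, hω]
  have hE0 : ∫ ω, (Λ₂ ω : ℝ) ∂Q ≠ 0 := by
    rw [hE]; exact mul_ne_zero (mul_ne_zero hκ₂.ne' hb) ha
  have hgE := h.integral_pow_mul hE0 hs
  rw [h.mixedPoisson₂.integral_deriv_pow hm₂ hn₂ hs, hE] at hgE
  -- The size-biased generating function, with the common factor κ₂ b₁ of λ₂ cancelled. It turns
  -- a₁(1 - g) into the integral of x(1 - exp(…)).
  have hga : g * a₁ = ∫ ω', x ω' * Real.exp (-((1 - s) * (x ω' * (κ₂ * b₁)))) ∂P := by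
    have : ∫ ω, lam₂ ω * Real.exp (-(lam₂ ω * (1 - s))) ∂P =
        κ₂ * b₁ * ∫ ω', x ω' * Real.exp (-((1 - s) * (x ω' * (κ₂ * b₁)))) ∂P := by
      rw [← integral_const_mul]
      refine integral_congr_ae (Eventually.of_forall fun ω => ?_)
      dsimp only
      rw [h₂, mul_assoc (κ₂ * b₁)]
      congr 4
      ring
    rw [this] at hgE
    refine mul_left_cancel₀ (mul_ne_zero hκ₂.ne' hb) ?_
    rw [← hgE]; ring
  refine Eventually.of_forall fun ω => ?_
  dsimp only
  rw [hR, ← hga, h₁]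
  congr 2
  ring

end Limit

theorem theorem1 {Ω : Type*} [MeasurableSpace Ω] (P : Measure Ω) [IsProbabilityMeasure P]
    (a b : ℝ) (ha : 0 < a) (hab : a < b)
    (X Y : ℕ+ → Ω → ℝ) (H : Ω → ℕ+ → ℕ+ → Prop)
    (hH : IsRandomBipartiteGraph P a b (fun t => (t : ℝ)) X Y H)
    (hX : Integrable (fun ω => X 1 ω ^ 2) P) (hY : Integrable (Y 1) P)
    (lam₁ lam₂ : Ω → ℝ)
    (hlam₁ : ∀ ω, lam₁ ω = 2 * (b ^ (1 / 2 : ℝ) - a ^ (1 / 2 : ℝ)) * (∫ ω', X 1 ω' ∂P) * Y 1 ω)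
    (hlam₂ : ∀ ω, lam₂ ω = 2 * (a ^ (-1 / 2 : ℝ) - b ^ (-1 / 2 : ℝ)) * (∫ ω', Y 1 ω' ∂P) * X 1 ω) :
    -- the variables `Λ₁, Λ₂, ϰ_1, ϰ_2, …` exist,
    (∃ (Ω' : Type) (_ : MeasurableSpace Ω') (Q : Measure Ω') (_ : IsProbabilityMeasure Q)
        (Λ₁ Λ₂ : Ω' → ℕ) (ϰ : ℕ → Ω' → ℕ), IsCompoundFamily P lam₁ lam₂ Q Λ₁ Λ₂ ϰ) ∧
    -- and, however they are realized, `d(v_t)` converges in distribution to `∑_{j ≤ Λ₁} ϰ_j`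
    (∀ (Ω' : Type*) [MeasurableSpace Ω'] (Q : Measure Ω') [IsProbabilityMeasure Q]
        (Λ₁ Λ₂ : Ω' → ℕ) (ϰ : ℕ → Ω' → ℕ), IsCompoundFamily P lam₁ lam₂ Q Λ₁ Λ₂ ϰ →
      TendstoInDistribution (fun (t : ℕ+) ω => vertexDegree (H ω) t) atTop
        (fun ω' => ∑ j ∈ Finset.range (Λ₁ ω'), ϰ j ω') (fun _ => P) Q) := by
  have hb := ha.trans hab
  have hXm := hH.measurable_X 1
  have hYm := hH.measurable_Y 1
  have hXi := hH.integrable_X hX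
  have hrpow {c : ℝ} (hc : 0 < c) : c ^ (-1 / 2 : ℝ) = √c⁻¹ := by
    rw [Real.sqrt_inv, Real.sqrt_eq_rpow, ← Real.rpow_neg hc.le]
    norm_num
  rw [← Real.sqrt_eq_rpow, ← Real.sqrt_eq_rpow] at hlam₁
  rw [hrpow ha, hrpow hb] at hlam₂
  have hκ₁ : 0 ≤ 2 * (√b - √a) := by
    have := Real.sqrt_le_sqrt hab.le
    linarith
  have hκ₂ : 0 < 2 * (√a⁻¹ - √b⁻¹) := by
    have := Real.sqrt_lt_sqrt (inv_pos.2 hb).le (inv_strictAnti₀ ha hab)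
    linarith
  have ha₁ : 0 ≤ ∫ ω, X 1 ω ∂P := integral_nonneg_of_ae (hH.nonneg_X 1)
  have hb₁ : 0 ≤ ∫ ω, Y 1 ω ∂P := integral_nonneg_of_ae (hH.nonneg_Y 1)
  refine ⟨exists_isCompoundFamily ?_ ?_ ?_ ?_ ?_, fun Ω' _ Q _ Λ₁ Λ₂ ϰ h => ?_⟩
  · rw [funext hlam₁]; fun_prop
  · filter_upwards [hH.nonneg_Y 1] with ω hω
    rw [hlam₁]; positivity
  · rw [funext hlam₂]; fun_prop
  · filter_upwards [hH.nonneg_X 1] with ω hω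
    rw [hlam₂]; positivity
  · rw [funext hlam₂]; exact hXi.const_mul _
  · refine tendstoInDistribution_of_tendsto_pgf
      (fun t => hH.aemeasurable_vertexDegree ha hb t) h.measurable_sum.aemeasurable fun s hs hs1 => ?_
    rw [h.integral_pow_sum_eq hXi hXm hYm hY (hH.nonneg_X 1) (hH.nonneg_Y 1) hκ₁ hκ₂ hlam₁ hlam₂
      hs hs1]
    exact hH.tendsto_integral_pow_degree ha hab.le hX hY hs hs1
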